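/- The isogeny class of an abelian variety over a general number field is not determined by its $L$-series: it is not true that, for every number field $K$, any two elliptic curves over $K$ with the same $L$-series are isogenous over $K$. More precisely, let $K=\mathbb{Q}(i)$, let $\sigma$ be the automorphism of $K$ with $\sigma(i)=-i$, let $E$ be the curve $y^2=x^3+ix$ over $K$ and let $E^\sigma: y^2=x^3-ix$ be its Galois conjugate. Let $L_{\mathfrak p}(E/K,T)$ be the local polynomial of $E$ at a prime $\mathfrak p$ of $K$: it is $1-a_{\mathfrak p}T+N\mathfrak p\,T^2$, with $a_{\mathfrak p}=N\mathfrak p+1-\#\tilde E(\mathbb{F}_{\mathfrak p})$, if $E$ has good reduction $\tilde E$ at $\mathfrak p$, and it is $1-T$, $1+T$, $1$ if $E$ has split multiplicative, non-split multiplicative, additive reduction at $\mathfrak p$. Let $L(E/K,s)=\prod_{\mathfrak p}L_{\mathfrak p}(E/K,N\mathfrak p^{-s})^{-1}$. Put $\mathfrak p_1=(2+i)$ and $\mathfrak p_2=(2-i)$, which are prime ideals of $\mathbb{Z}[i]$. Then: 1. $E$ and $E^\sigma$ are elliptic curves, and $L(E/K,s)=L(E^\sigma/K,s)$, as formal Dirichlet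 series and as functions of $s$. 2. $E$ and $E^\sigma$ are not isogenous over $K$: there is no homomorphism $E\to E^\sigma$ of algebraic groups defined over $K$ that is surjective with finite kernel. 3. $E$ has good reduction at $\mathfrak p_1$ and at $\mathfrak p_2$, and $E^\sigma$ has good reduction at $\mathfrak p_2$. The reduction of $E$ at $\mathfrak p_1$ has $10$ points over the residue field, the reduction of $E$ at $\mathfrak p_2$ has $2$ points, and the reduction of $E^\sigma$ at $\mathfrak p_2$ has $10$ points. Moreover $L_{\mathfrak p_2}(E/K,T)\neq L_{\mathfrak p_1}(E/K,T)=L_{\mathfrak p_2}(E^\sigma/K,T)$. -/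

import Mathlib

open NumberField IsDedekindDomain

noncomputable section

/-! ### Isogenies of elliptic curves over a field -/

namespace EllipticIsogeny

/-- Homogeneous coordinates in the projective plane of a point of a Weierstrass curve. -/
def homCoord {F : Type*} [CommRing F] {W : WeierstrassCurve F} :
    W.toAffine.Point → Fin 3 → F
  | .zero => ![0, 1, 0]
  | .some x y _ => ![x, y, 1]

variable {K : Type*} [Field K]

/-- The group of geometric points `E(K̄)` of a Weierstrass curve `E` over `K`. -/
abbrev GeomPoint (E : WeierstrassCurve K) : Type _ :=
  (E.baseChange (AlgebraicClosure K)).toAffine.Point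

/-- The value at a geometric point `Q` of a triple of ternary forms with coefficients in `K`. -/
def evalForms {E : WeierstrassCurve K} (F : Fin 3 → MvPolynomial (Fin 3) K) (Q : GeomPoint E) :
    Fin 3 → AlgebraicClosure K :=
  fun j => MvPolynomial.aeval (homCoord Q) (F j)

/-- `φ : E(K̄) → E'(K̄)` is a morphism of projective curves defined over `K`: around every point `P`
it is given by three forms of the same degree with coefficients in `K`, not all vanishing at `P`,
that compute `φ(Q)` in homogeneous coordinates wherever they do not vanish simultaneously. -/
def IsMorphismOver {E E' : WeierstrassCurve K} (φ : GeomPoint E → GeomPoint E') : Prop :=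
  ∀ P : GeomPoint E, ∃ (d : ℕ) (F : Fin 3 → MvPolynomial (Fin 3) K),
    (∀ j, (F j).IsHomogeneous d) ∧ evalForms F P ≠ 0 ∧
    ∀ Q : GeomPoint E, evalForms F Q ≠ 0 →
      ∃ c : AlgebraicClosure K, evalForms F Q = c • homCoord (φ Q)

open scoped Classical in
/-- An isogeny `E → E'` over `K`: a homomorphism of algebraic groups defined over `K` that is
surjective with finite kernel (on geometric points). -/
structure IsIsogeny {E E' : WeierstrassCurve K} (φ : GeomPoint E →+ GeomPoint E') : Prop where
  morphism : IsMorphismOver (E := E) (E' := E') φ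
  surjective : Function.Surjective φ
  finite_ker : (φ.ker : Set (GeomPoint E)).Finite

open scoped Classical in
/-- `E` and `E'` are isogenous over `K`. -/
def Isogenous (E E' : WeierstrassCurve K) : Prop :=
  ∃ φ : GeomPoint E →+ GeomPoint E', IsIsogeny φ

end EllipticIsogeny

/-! ### Reduction at a prime of a number field -/

namespace EllipticReduction

variable {K : Type*} [Field K] [NumberField K]

/-- A minimal Weierstrass equation of `E` over the completion of `K` at the prime `𝔭`. -/
abbrev minimalAt (E : WeierstrassCurve K) (𝔭 : HeightOneSpectrum (𝓞 K)) :
    WeierstrassCurve (𝔭.adicCompletion K) :=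
  (E.baseChange (𝔭.adicCompletion K)).minimal (𝔭.adicCompletionIntegers K)

/-- `E` has good reduction at the prime `𝔭`. -/
def GoodReductionAt (E : WeierstrassCurve K) (𝔭 : HeightOneSpectrum (𝓞 K)) : Prop :=
  (minimalAt E 𝔭).HasGoodReduction (𝔭.adicCompletionIntegers K)

/-- The number of points, over the residue field of `𝔭`, of the reduction of `E` at `𝔭`. -/
def reductionPointCount (E : WeierstrassCurve K) (𝔭 : HeightOneSpectrum (𝓞 K)) : ℕ :=
  Nat.card ((minimalAt E 𝔭).reduction (𝔭.adicCompletionIntegers K)).toAffine.Point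

/-- The local polynomial `L_𝔭(E/K, T)`, normalised in the variable `T = (N𝔭)^{-s}`. -/
def localPolynomialAt (E : WeierstrassCurve K) (𝔭 : HeightOneSpectrum (𝓞 K)) : Polynomial ℤ :=
  (E.baseChange (𝔭.adicCompletion K)).localPolynomial (𝔭.adicCompletionIntegers K)

end EllipticReduction

/-! ### The field `ℚ(i)` and the curve `y² = x³ + ix` -/

namespace GaussianField

/-- The number field `ℚ(i)`, as a subfield of `ℂ`. -/
abbrev QI : IntermediateField ℚ ℂ := IntermediateField.adjoin ℚ {Complex.I}

theorem isIntegral_complex_I {R : Type*} [CommRing R] [Algebra R ℂ] : IsIntegral R Complex.I :=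
  ⟨Polynomial.X ^ 2 + 1, by monicity!, by simp⟩

instance : NumberField QI where
  to_charZero := inferInstance
  to_finiteDimensional := IntermediateField.adjoin.finiteDimensional isIntegral_complex_I

/-- The element `i` of `ℚ(i)`. -/
def i : QI := IntermediateField.AdjoinSimple.gen ℚ Complex.I

theorem i_sq : i ^ 2 = -1 := by
  apply Subtype.ext
  simp [i]

/-- The element `i` of the ring of integers of `ℚ(i)`. -/
def iInt : 𝓞 QI :=
  ⟨i, Polynomial.X ^ 2 + 1, by monicity!, by simp [i_sq]⟩

/-- The curve `y² = x³ + ix` over `ℚ(i)`. -/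
def E : WeierstrassCurve QI where
  a₁ := 0
  a₂ := 0
  a₃ := 0
  a₄ := i
  a₆ := 0

end GaussianField

end

open EllipticIsogeny EllipticReduction GaussianField

/-! Equality of $L$-series is formal: conjugation $\sigma$ permutes the primes of $K$, and the Euler
factor of $E^\sigma$ at $\sigma\mathfrak p$ is that of $E$ at $\mathfrak p$ (`LFunction_conj`).
Since local factors are read off a chosen minimal equation over a completion, this needs
isomorphisms of completions (`exists_adicCompletion_equiv`) and uniqueness of minimal equations
(`exists_integralModel_eq_smul`). As $c_4^3 = 1728\Delta$, multiplicative reduction never occurs.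

For non-isogeny, let $\zeta^2 = -i$. The curves become isomorphic over $K(\zeta)$ by $(x, y) \mapsto
(\zeta^2 x, \zeta^3 y)$. Composing this with a $K$-homomorphism $\varphi : E \to E^\sigma$ gives an
additive map $A$ on $E(\bar K)$ such that $Ag = -gA$ for any Galois $g$ with $g\zeta = -\zeta$.
Multiplication by $i$ makes $E(\bar K)$ a $\mathbb{Z}[i]$-module whose $(1+i)$-power torsion is
divisible, with cyclic layers, so $g$ acts on each $E[2^m]$ as some $\alpha \in \mathbb{Z}[i]$.
Explicit $4$-torsion shows $\operatorname{Re}\alpha \equiv 2 \pmod 4$. Since $A$ commutes with $g^2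
= 2\operatorname{Re}(\alpha)\, g - N\alpha$ and anticommutes with $g$, it follows that
$4\operatorname{Re}(\alpha) A = 0$, hence $8A = 0$ on $E[2^m]$; by divisibility $A$ kills all
$2$-power torsion (`eq_zero_of_anticommute`). So $\ker\varphi$ is infinite
(`infinite_ker_of_equivariant`). Only additivity of $A$ is used, not the structure of the
endomorphism ring.

The point counts are computed over $\mathbb{F}_5$ and transported by conjugation. -/

noncomputable section

/-! ### Modules over the Gaussian integers and anticommuting maps. -/

namespace GaussianModule

/-- The imaginary unit of the Gaussian integers. -/
abbrev I : GaussianInt := ⟨0, 1⟩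

/-- The prime `1 + i` of the Gaussian integers. -/
abbrev lam : GaussianInt := ⟨1, 1⟩

/-- The module over the Gaussian integers given by an endomorphism of square `-1`. -/
abbrev ofEnd {M : Type*} [AddCommGroup M] (J : M →+ M) (hJ : ∀ P, J (J P) = -P) :
    Module GaussianInt M where
  smul α P := α.re • P + α.im • J P
  one_smul P := by
    change (1 : GaussianInt).re • P + (1 : GaussianInt).im • J P = P
    simp
  mul_smul α β P := by
    change (α * β).re • P + (α * β).im • J P =
      α.re • (β.re • P + β.im • J P) + α.im • J (β.re • P + β.im • J P)
    simp only [Zsqrtd.re_mul, Zsqrtd.im_mul, map_add, map_zsmul, hJ]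
    module
  smul_zero α := by
    change α.re • (0 : M) + α.im • J 0 = 0
    simp
  smul_add α P Q := by
    change α.re • (P + Q) + α.im • J (P + Q) = (α.re • P + α.im • J P) + (α.re • Q + α.im • J Q)
    rw [map_add]
    module
  add_smul α β P := by
    change (α + β).re • P + (α + β).im • J P = (α.re • P + α.im • J P) + (β.re • P + β.im • J P)
    simp only [Zsqrtd.re_add, Zsqrtd.im_add]
    module
  zero_smul P := by
    change (0 : GaussianInt).re • P + (0 : GaussianInt).im • J P = 0
    simp

lemma four_eq : (4 : GaussianInt) = -lam ^ 4 := by decide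

lemma two_eq : (2 : GaussianInt) = -I * lam ^ 2 := by decide

variable {M : Type*} [AddCommGroup M] [Module GaussianInt M] {T : M}

lemma exists_lam_pow_smul_eq (surj : ∀ P : M, ∃ Q : M, lam • Q = P) (n : ℕ) (P : M) :
    ∃ Q : M, lam ^ n • Q = P := by
  induction n with
  | zero => exact ⟨P, by simp⟩
  | succ n ih =>
    obtain ⟨Q, rfl⟩ := ih
    obtain ⟨R, rfl⟩ := surj Q
    exact ⟨R, by rw [pow_succ, mul_smul]⟩

/-- An element of the kernel of `(1 + i) ^ (n + 1)` that is not in the kernel of `(1 + i) ^ n`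
generates the former. -/
lemma exists_smul_eq_of_lam_pow_smul (ker : ∀ P : M, lam • P = 0 → P = 0 ∨ P = T) (n : ℕ) :
    ∀ P Q : M, lam ^ n • P = T → lam ^ (n + 1) • Q = 0 → ∃ α : GaussianInt, Q = α • P := by
  induction n with
  | zero =>
    intro P Q hP hQ
    rw [pow_zero, one_smul] at hP
    rw [zero_add, pow_one] at hQ
    rcases ker Q hQ with h | h
    · exact ⟨0, by rw [h, zero_smul]⟩
    · exact ⟨1, by rw [h, hP, one_smul]⟩
  | succ n ih =>
    intro P Q hP hQ
    obtain ⟨α, hα⟩ := ih (lam • P) (lam • Q) (by rw [← mul_smul, ← pow_succ, hP])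
      (by rw [← mul_smul, ← pow_succ, hQ])
    have h : lam • (Q - α • P) = 0 := by
      rw [smul_sub, hα, smul_comm, sub_self]
    rcases ker _ h with h | h
    · exact ⟨α, by rwa [sub_eq_zero] at h⟩
    -- The remaining difference is `T`, which is itself `lam ^ (n + 1) • P`.
    · exact ⟨α + lam ^ (n + 1), by rw [add_smul, hP, ← h]; abel⟩

/-- A linear automorphism that acts nontrivially on the `2`-torsion, and on the `4`-torsion not as
a unit, acts on the `4`-torsion as an element of real part `2`. -/
lemma exists_re_eq_of_smul_ne (hlamT : lam • T = 0) (hT : T ≠ 0)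
    (g : M →ₗ[GaussianInt] M) (hg : Function.Injective g) {P : M} (hP : lam ^ 3 • P = T)
    (h2 : g (lam ^ 2 • P) ≠ lam ^ 2 • P) (hI : g P ≠ I • P) (hI' : g P ≠ -(I • P))
    {α : GaussianInt} (hα : g P = α • P) : ∃ k : ℤ, α.re = 4 * k + 2 := by
  have h4 : lam ^ 4 • P = 0 := by rw [pow_succ', mul_smul, hP, hlamT]
  have h4' : (4 : GaussianInt) • P = 0 := by rw [four_eq, neg_smul, h4, neg_zero]
  obtain ⟨a, b⟩ := α
  -- If `a + b` is even then `lam` divides `α`, and `g T = lam ^ 3 • g P` is a multiple of `lam ^ 4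
  -- • P = 0`.
  have hsum : ¬ ∃ m, a + b = 2 * m := by
    rintro ⟨m, hm⟩
    have hβ : (⟨a, b⟩ : GaussianInt) = ⟨m, m - a⟩ * lam := by
      ext
      · simp
      · simp
        lia
    have : g T = 0 := by
      rw [← hP, map_smul, hα, hβ, mul_smul, smul_comm, ← mul_smul (lam ^ 3), ← pow_succ, h4,
        smul_zero]
    exact hT (hg (this.trans (map_zero g).symm))
  -- If `a` is odd then `b` is even, so `α ≡ 1` modulo `2` and `g` fixes the `2`-torsion point `lam
  -- ^ 2 • P`.
  have ha : ¬ ∃ m, a = 2 * m + 1 := by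
    rintro ⟨m, hm⟩
    obtain ⟨l, hl⟩ : ∃ l, b = 2 * l := ⟨b / 2, by
      by_contra hb
      exact hsum ⟨m + 1 + b / 2, by lia⟩⟩
    have hβ : (⟨a, b⟩ : GaussianInt) = 1 + ⟨m, l⟩ * 2 := by
      ext <;> simp <;> lia
    apply h2
    rw [map_smul, hα, hβ, add_smul, one_smul, smul_add, mul_smul, smul_comm, two_eq, mul_smul,
      smul_comm (lam ^ 2) (-I), ← mul_smul (lam ^ 2), ← pow_add, h4, smul_zero, smul_zero, add_zero]
  -- Now `a` is even and `b` odd; if `4 ∣ a` then `α ≡ ±I` modulo `4`, which the action on `P`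
  -- excludes.
  by_contra hk
  obtain ⟨m, hm⟩ : ∃ m, a = 4 * m := ⟨a / 4, by
    by_contra h
    have : a % 4 = 1 ∨ a % 4 = 2 ∨ a % 4 = 3 := by lia
    rcases this with h | h | h
    · exact ha ⟨a / 2, by lia⟩
    · exact hk ⟨a / 4, by change a = _; lia⟩
    · exact ha ⟨a / 2, by lia⟩⟩
  have hb : b % 4 = 1 ∨ b % 4 = 3 := by
    by_contra h
    exact hsum ⟨(a + b) / 2, by lia⟩
  rcases hb with hb | hb
  · have hβ : (⟨a, b⟩ : GaussianInt) = I + ⟨m, b / 4⟩ * 4 := by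
      ext <;> simp <;> lia
    exact hI (by rw [hα, hβ, add_smul, mul_smul, h4', smul_zero, add_zero])
  · have hβ : (⟨a, b⟩ : GaussianInt) = -I + ⟨m, b / 4 + 1⟩ * 4 := by
      ext <;> simp <;> lia
    exact hI' (by rw [hα, hβ, add_smul, mul_smul, h4', smul_zero, add_zero, neg_smul])

/-- An additive map that anticommutes with such a linear automorphism vanishes on all torsion of
order a power of `1 + i`. -/
theorem eq_zero_of_anticommute (ker : ∀ P : M, lam • P = 0 → P = 0 ∨ P = T) (hlamT : lam • T = 0)
    (hT : T ≠ 0) (surj : ∀ P : M, ∃ Q : M, lam • Q = P)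
    (g : M →ₗ[GaussianInt] M) (hg : Function.Injective g) {P : M} (hP : lam ^ 3 • P = T)
    (h2 : g (lam ^ 2 • P) ≠ lam ^ 2 • P) (hI : g P ≠ I • P) (hI' : g P ≠ -(I • P))
    (A : M →+ M) (hA : ∀ Q, A (g Q) = -g (A Q)) (n : ℕ) (R : M) (hR : lam ^ n • R = 0) :
    A R = 0 := by
  have two_pow : ∀ m : ℕ, ∃ u v : GaussianInt, (2 : GaussianInt) ^ m = u * lam ^ (2 * m) ∧
      lam ^ (2 * m) = v * 2 ^ m := fun m ↦
    ⟨(-I) ^ m, I ^ m, by rw [two_eq, mul_pow, pow_mul], by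
      rw [two_eq, mul_pow, ← mul_assoc, ← mul_pow, show I * -I = 1 by decide, one_pow, one_mul,
        pow_mul]⟩
  -- every `2`-power torsion element is multiplied by a scalar
  have scalar : ∀ m : ℕ, ∃ α : GaussianInt, (∃ k : ℤ, α.re = 4 * k + 2) ∧
      ∀ Q : M, (2 : GaussianInt) ^ m • Q = 0 → g Q = α • Q := by
    intro m
    -- `S` generates the kernel of `lam ^ (2 * m + 4)`, which contains the `2 ^ m`-torsion, so the
    -- scalar by which `g` moves `S` serves for all of it. It also serves for `P`, which determines
    -- its real part modulo `4`.
    obtain ⟨S, hS⟩ := exists_lam_pow_smul_eq surj (2 * m) P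
    have hST : lam ^ (2 * m + 3) • S = T := by rw [add_comm, pow_add, mul_smul, hS, hP]
    have hS0 : lam ^ (2 * m + 3 + 1) • S = 0 := by rw [pow_succ', mul_smul, hST, hlamT]
    obtain ⟨α, hα⟩ := exists_smul_eq_of_lam_pow_smul ker _ S (g S) hST
      (by rw [← map_smul, hS0, map_zero])
    refine ⟨α, exists_re_eq_of_smul_ne hlamT hT g hg hP h2 hI hI' ?_, fun Q hQ ↦ ?_⟩
    · rw [← hS, map_smul, hα, smul_comm]
    · obtain ⟨u, v, -, hv⟩ := two_pow m
      obtain ⟨β, rfl⟩ := exists_smul_eq_of_lam_pow_smul ker _ S Q hST (by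
        rw [show 2 * m + 3 + 1 = 4 + 2 * m by ring, pow_add, hv, mul_smul, mul_smul, hQ, smul_zero,
          smul_zero])
      rw [map_smul, hα, smul_comm]
  have two_smul_map : ∀ (m : ℕ) (Q : M), A ((2 : GaussianInt) ^ m • Q) =
      (2 : GaussianInt) ^ m • A Q := fun m Q ↦ by
    have h : ∀ X : M, (2 : GaussianInt) ^ m • X = (2 ^ m : ℕ) • X := fun X ↦ by
      rw [← Nat.cast_smul_eq_nsmul GaussianInt]; norm_num
    rw [h, h, map_nsmul]
  have eight : ∀ (m : ℕ) (Q : M), (2 : GaussianInt) ^ (m + 3) • Q = 0 → A ((8 : ℕ) • Q) = 0 := by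
    intro m Q hQ
    obtain ⟨α, ⟨k, hk⟩, hα⟩ := scalar (m + 3)
    have hAQ : (2 : GaussianInt) ^ (m + 3) • A Q = 0 := by rw [← two_smul_map, hQ, map_zero]
    -- The quadratic equation of `α`, with trace `2 * α.re` and norm `α.re ^ 2 + α.im ^ 2`. Unlike
    -- `α` itself it has integer coefficients, so the additive map `A` respects it.
    have hgg : ∀ X : M, (2 : GaussianInt) ^ (m + 3) • X = 0 →
        g (g X) = (2 * α.re) • g X - (α.re ^ 2 + α.im ^ 2) • X := by
      intro X hX
      have hgX : (2 : GaussianInt) ^ (m + 3) • g X = 0 := by rw [← map_smul, hX, map_zero]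
      rw [hα _ hgX, hα _ hX, ← Int.cast_smul_eq_zsmul GaussianInt,
        ← Int.cast_smul_eq_zsmul GaussianInt, ← mul_smul, ← mul_smul, ← sub_smul]
      congr 1
      ext <;> simp [pow_two] <;> ring
    have h1 : A (g (g Q)) = g (g (A Q)) := by rw [hA, hA, map_neg, neg_neg]
    rw [hgg Q hQ, hgg _ hAQ, map_sub, map_zsmul, map_zsmul, hA] at h1
    have h3 : (4 * α.re) • g (A Q) = 0 := by
      have := sub_eq_zero.mpr h1
      rw [← neg_eq_zero, ← this]
      module
    have h5 : (4 * α.re) • A Q = 0 := by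
      apply hg
      rw [map_zsmul, h3, map_zero]
    -- `4 α.re = 8 (2 k + 1)`, and `A Q` is killed by a power of two
    have h6 : ((2 ^ (m + 3) : ℕ) : ℤ) • A Q = 0 := by
      rw [← Int.cast_smul_eq_zsmul GaussianInt]
      simpa using hAQ
    obtain ⟨x, y, hxy⟩ : IsCoprime (2 * k + 1) ((2 ^ m : ℕ) : ℤ) := by
      push_cast
      exact IsCoprime.pow_right ⟨1, -k, by ring⟩
    have h7 : (8 : ℤ) = x * (4 * α.re) + y * (2 ^ (m + 3) : ℕ) := by
      rw [hk]
      push_cast at hxy ⊢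
      linear_combination (-8) * hxy
    rw [map_nsmul, ← natCast_zsmul, Nat.cast_ofNat, h7, add_smul, mul_smul x, mul_smul y, h5, h6,
      smul_zero, smul_zero, add_zero]
  -- Up to a unit, `8` is `lam ^ 6`; so `R` is `8` times a torsion element, and the previous bound
  -- applies to that element.
  obtain ⟨S, hS⟩ := exists_lam_pow_smul_eq surj 6 R
  obtain ⟨u, v, hu, hv⟩ := two_pow 3
  obtain ⟨u', v', hu', hv'⟩ := two_pow (n + 3)
  have h8 : R = (8 : ℕ) • (v • S) := by
    rw [← hS, show (6 : ℕ) = 2 * 3 by norm_num, hv, ← Nat.cast_smul_eq_nsmul GaussianInt,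
      ← mul_smul]
    congr 1
    push_cast
    ring
  rw [h8]
  apply eight n
  rw [hu', show 2 * (n + 3) = n + (n + 6) by ring, smul_comm, mul_smul, pow_add, mul_smul,
    add_comm n 6, pow_add, mul_comm (lam ^ 6), mul_smul _ (lam ^ 6), hS, hR]
  simp

/-- The `(1 + i)`-power torsion of a divisible module is infinite, if it is nonzero. -/
theorem infinite_torsion (hlamT : lam • T = 0) (hT : T ≠ 0)
    (surj : ∀ P : M, ∃ Q : M, lam • Q = P) : {P : M | ∃ n : ℕ, lam ^ n • P = 0}.Infinite := by
  -- Successive division of `T` by `lam` gives elements of strictly growing order.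
  choose f hf using fun n ↦ exists_lam_pow_smul_eq surj n T
  have hinj : Function.Injective f := by
    have key : ∀ m n, m < n → f m ≠ f n := by
      intro m n hmn h
      obtain ⟨k, rfl⟩ := Nat.exists_eq_add_of_lt hmn
      apply hT
      rw [← hf (m + k + 1), ← h, show m + k + 1 = (k + 1) + m by ring, pow_add, mul_smul, hf m,
        pow_succ, mul_smul, hlamT, smul_zero]
    intro m n h
    rcases lt_trichotomy m n with hmn | hmn | hmn
    · exact (key m n hmn h).elim
    · exact hmn
    · exact (key n m hmn h.symm).elim
  refine (Set.infinite_range_of_injective hinj).mono ?_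
  rintro _ ⟨n, rfl⟩
  exact ⟨n + 1, by rw [pow_succ', mul_smul, hf, hlamT]⟩

end GaussianModule

end

/-! ### Semilinear scalings of Weierstrass curves as group homomorphisms. -/

noncomputable section

namespace WeierstrassCurve.Affine

variable {F F' : Type*} [Field F] [Field F']

/-- `W'` is obtained from `W` by applying `f` and scaling the variables by `u`. -/
structure IsScaling (f : F →+* F') (u : F'ˣ) (W : WeierstrassCurve F) (W' : WeierstrassCurve F') :
    Prop where
  a₁ : W'.a₁ = u * f W.a₁
  a₂ : W'.a₂ = u ^ 2 * f W.a₂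
  a₃ : W'.a₃ = u ^ 3 * f W.a₃
  a₄ : W'.a₄ = u ^ 4 * f W.a₄
  a₆ : W'.a₆ = u ^ 6 * f W.a₆

namespace IsScaling

variable {f : F →+* F'} {u : F'ˣ} {W : WeierstrassCurve F} {W' : WeierstrassCurve F'}

lemma X_inj {x₁ x₂ : F} : (u : F') ^ 2 * f x₁ = u ^ 2 * f x₂ ↔ x₁ = x₂ := by
  rw [mul_right_inj' (pow_ne_zero _ u.ne_zero), f.injective.eq_iff]

lemma Y_inj {y₁ y₂ : F} : (u : F') ^ 3 * f y₁ = u ^ 3 * f y₂ ↔ y₁ = y₂ := by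
  rw [mul_right_inj' (pow_ne_zero _ u.ne_zero), f.injective.eq_iff]

variable (h : IsScaling f u W W')

include h

lemma negY (x y : F) :
    W'.toAffine.negY (u ^ 2 * f x) (u ^ 3 * f y) = u ^ 3 * f (W.toAffine.negY x y) := by
  simp only [Affine.negY, h.a₁, h.a₃, map_sub, map_neg, map_mul]
  ring

lemma nonsingular {x y : F} (hxy : W.toAffine.Nonsingular x y) :
    W'.toAffine.Nonsingular (u ^ 2 * f x) (u ^ 3 * f y) := by
  rw [Affine.nonsingular_iff, Affine.equation_iff] at hxy ⊢
  obtain ⟨h1, h2⟩ := hxy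
  have hu : (u : F') ≠ 0 := u.ne_zero
  have h1' := congrArg f h1
  simp only [map_add, map_mul, map_pow] at h1'
  refine ⟨?_, ?_⟩
  · simp only [h.a₁, h.a₂, h.a₃, h.a₄, h.a₆]
    linear_combination (u : F') ^ 6 * h1'
  · contrapose! h2
    obtain ⟨h3, h4⟩ := h2
    simp only [h.a₁, h.a₂, h.a₃, h.a₄] at h3 h4
    constructor
    · apply f.injective
      apply mul_left_cancel₀ (pow_ne_zero 4 hu)
      simp only [map_add, map_mul, map_pow, map_ofNat]
      linear_combination h3
    · apply f.injective
      apply mul_left_cancel₀ (pow_ne_zero 3 hu)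
      simp only [map_sub, map_neg, map_mul]
      linear_combination h4

lemma slope [DecidableEq F] [DecidableEq F'] (x₁ x₂ y₁ y₂ : F) :
    W'.toAffine.slope (u ^ 2 * f x₁) (u ^ 2 * f x₂) (u ^ 3 * f y₁) (u ^ 3 * f y₂) =
      u * f (W.toAffine.slope x₁ x₂ y₁ y₂) := by
  have hu : (u : F') ≠ 0 := u.ne_zero
  simp only [Affine.slope, h.negY, X_inj, Y_inj]
  split_ifs
  · simp
  · simp only [h.a₁, h.a₂, h.a₄, map_div₀, map_sub, map_add, map_mul, map_pow, map_ofNat]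
    rw [← mul_sub]
    conv_rhs => rw [mul_div_assoc', ← mul_div_mul_left _ _ (pow_ne_zero 3 hu)]
    congr 1
    ring
  · simp only [map_div₀, map_sub]
    rw [← mul_sub, ← mul_sub]
    conv_rhs => rw [mul_div_assoc', ← mul_div_mul_left _ _ (pow_ne_zero 2 hu)]
    congr 1
    ring

/-- The homomorphism `(x, y) ↦ (u² f(x), u³ f(y))` of groups of points. -/
def pointHom [DecidableEq F] [DecidableEq F'] : W.toAffine.Point →+ W'.toAffine.Point where
  toFun P := match P with
    | .zero => .zero
    | .some _ _ hxy => .some _ _ (h.nonsingular hxy)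
  map_zero' := rfl
  map_add' := by
    rintro (_ | ⟨x₁, y₁, h₁⟩) (_ | ⟨x₂, y₂, h₂⟩)
    any_goals rfl
    by_cases hxy : x₁ = x₂ ∧ y₁ = W.toAffine.negY x₂ y₂
    · rw [Point.add_of_Y_eq hxy.1 hxy.2,
        Point.add_of_Y_eq (X_inj.mpr hxy.1) (by rw [h.negY, hxy.2])]
      rfl
    · rw [Point.add_some hxy, Point.add_some (by rwa [X_inj, h.negY, Y_inj])]
      simp only [Point.some.injEq, h.slope]
      constructor
      · simp only [Affine.addX, h.a₁, h.a₂, map_sub, map_add, map_mul, map_pow]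
        ring
      · simp only [Affine.addY, Affine.negAddY, Affine.negY, Affine.addX, h.a₁, h.a₂, h.a₃, map_sub,
          map_add, map_mul, map_pow, map_neg]
        ring

lemma pointHom_some [DecidableEq F] [DecidableEq F'] {x y : F} (hxy : W.toAffine.Nonsingular x y) :
    h.pointHom (.some x y hxy) = .some _ _ (h.nonsingular hxy) := rfl

lemma pointHom_injective [DecidableEq F] [DecidableEq F'] : Function.Injective h.pointHom := by
  rintro (_ | ⟨x₁, y₁, h₁⟩) (_ | ⟨x₂, y₂, h₂⟩) hP
  · rfl
  · cases hP
  · cases hP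
  · rw [pointHom_some, pointHom_some, Point.some.injEq, X_inj, Y_inj] at hP
    simpa using hP

end IsScaling

end WeierstrassCurve.Affine

end

/-! ### The curves y² = x³ + ax and their complex multiplication. -/

noncomputable section

namespace WeierstrassCurve.Affine

variable {F : Type*} [Field F]

/-- `W` is the curve `y² = x³ + ax`, in a field of characteristic other than `2`. -/
structure IsQuartic (a : F) (W : WeierstrassCurve F) : Prop where
  two_ne_zero : (2 : F) ≠ 0
  ne_zero : a ≠ 0
  a₁ : W.a₁ = 0
  a₂ : W.a₂ = 0
  a₃ : W.a₃ = 0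
  a₄ : W.a₄ = a
  a₆ : W.a₆ = 0

namespace IsQuartic

variable {a : F} {W : WeierstrassCurve F}

lemma equation_iff (h : IsQuartic a W) {x y : F} :
    W.toAffine.Equation x y ↔ y ^ 2 = x ^ 3 + a * x := by
  rw [Affine.equation_iff, h.a₁, h.a₂, h.a₃, h.a₄, h.a₆]
  simp

lemma nonsingular_iff (h : IsQuartic a W) {x y : F} :
    W.toAffine.Nonsingular x y ↔ y ^ 2 = x ^ 3 + a * x := by
  rw [Affine.nonsingular_iff, h.equation_iff, h.a₁, h.a₂, h.a₃, h.a₄, and_iff_left_iff_imp]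
  intro hxy
  contrapose! hxy
  obtain ⟨h1, h2⟩ := hxy
  have hy : y = 0 := by
    have : 2 * y = 0 := by linear_combination h2
    exact (mul_eq_zero.mp this).resolve_left h.two_ne_zero
  subst hy
  intro h3
  have h4 : a * (2 * x) = 0 := by linear_combination (-3) * h3 + x * h1
  have hx : x = 0 := (mul_eq_zero.mp ((mul_eq_zero.mp h4).resolve_left h.ne_zero)).resolve_left
    h.two_ne_zero
  subst hx
  exact h.ne_zero (by linear_combination -h1)

lemma negY (h : IsQuartic a W) (x y : F) : W.toAffine.negY x y = -y := by
  simp [Affine.negY, h.a₁, h.a₃]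

lemma ext_sq (h : IsQuartic a W) {x y x' y' : F} (hxy : W.toAffine.Nonsingular x y)
    (hxy' : W.toAffine.Nonsingular x' y') (hx : x = x') (hy : y' = 0) :
    Point.some x y hxy = Point.some x' y' hxy' := by
  have h1 := h.nonsingular_iff.mp hxy
  have h2 := h.nonsingular_iff.mp hxy'
  subst hx hy
  simp only [Point.some.injEq, true_and]
  rw [← h2] at h1
  simpa using h1

/-- The automorphism `(x, y) ↦ (-x, iy)`. -/
lemma isScaling_neg_I (h : IsQuartic a W) {I : Fˣ} (hI : (I : F) ^ 2 = -1) :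
    IsScaling (RingHom.id F) (-I) W W where
  a₁ := by simp [h.a₁]
  a₂ := by simp [h.a₂]
  a₃ := by simp [h.a₃]
  a₄ := by
    simp only [h.a₄, RingHom.id_apply, Units.val_neg]
    linear_combination (-a) * (I ^ 2 - 1) * hI
  a₆ := by simp [h.a₆]

lemma nonsingular_mulI (h : IsQuartic a W) {I : Fˣ} (hI : (I : F) ^ 2 = -1) {x y : F}
    (hxy : W.toAffine.Nonsingular x y) : W.toAffine.Nonsingular (-x) (I * y) := by
  rw [h.nonsingular_iff] at hxy ⊢
  linear_combination (-1) * hxy + y ^ 2 * hI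

/-- The point `(0, 0)`. -/
def origin (h : IsQuartic a W) : W.toAffine.Point := .some 0 0 (h.nonsingular_iff.mpr (by simp))

lemma origin_ne_zero (h : IsQuartic a W) : h.origin ≠ 0 := Point.some_ne_zero _

variable [DecidableEq F] (h : IsQuartic a W) {I : Fˣ} (hI : (I : F) ^ 2 = -1)

/-- The action of the imaginary unit on the points of `y² = x³ + ax`. -/
def mulI : W.toAffine.Point →+ W.toAffine.Point := (h.isScaling_neg_I hI).pointHom

/-- The scaling factor is `-I` because `(-I) ^ 2 = -1` and `(-I) ^ 3 = I`. -/
lemma mulI_some {x y : F} (hxy : W.toAffine.Nonsingular x y) :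
    h.mulI hI (.some x y hxy) = .some (-x) (I * y) (h.nonsingular_mulI hI hxy) := by
  rw [mulI, IsScaling.pointHom_some]
  simp only [Point.some.injEq, Units.val_neg, RingHom.id_apply]
  constructor
  · linear_combination x * hI
  · linear_combination (-I * y) * hI

lemma mulI_mulI (P : W.toAffine.Point) : h.mulI hI (h.mulI hI P) = -P := by
  rcases P with _ | ⟨x, y, hxy⟩
  · rfl
  · simp only [mulI_some, Point.neg_some, Point.some.injEq, h.negY, neg_neg, true_and]
    linear_combination y * hI

lemma origin_add_mulI : h.origin + h.mulI hI h.origin = 0 := by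
  rw [origin, mulI_some]
  exact Point.add_of_Y_eq (by simp) (by rw [h.negY]; simp)

/-- The `x`-coordinate of `(1 + i) P`. -/
lemma exists_add_mulI_eq {x y : F} (hxy : W.toAffine.Nonsingular x y) (hx : x ≠ 0) :
    ∃ Y hY, Point.some x y hxy + h.mulI hI (.some x y hxy) =
      .some ((x ^ 2 + a) / (2 * I * x)) Y hY := by
  have h2 := h.two_ne_zero
  have hI0 : (I : F) ≠ 0 := I.ne_zero
  have hne : x ≠ -x := fun hx' ↦ by
    have : 2 * x = 0 := by linear_combination hx'
    exact (mul_ne_zero h2 hx) this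
  rw [mulI_some, Point.add_of_X_ne hne]
  have key : W.toAffine.addX x (-x) (W.toAffine.slope x (-x) y (I * y)) =
      (x ^ 2 + a) / (2 * I * x) := by
    rw [slope_of_X_ne hne, Affine.addX, h.a₁, h.a₂]
    have h3 := h.nonsingular_iff.mp hxy
    rw [show x - -x = 2 * x by ring]
    field_simp
    linear_combination (I * (1 - I) ^ 2) * h3 + (x ^ 3 + a * x) * (I - 2) * hI
  refine ⟨W.toAffine.addY x (-x) y (W.toAffine.slope x (-x) y (I * y)), ?_, ?_⟩
  · rw [← key]
    exact nonsingular_add hxy (h.nonsingular_mulI hI hxy) fun h' ↦ hne h'.1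
  · rw [Point.some.injEq]
    exact ⟨key, rfl⟩

lemma eq_zero_or_eq_origin_of_add_mulI (P : W.toAffine.Point) (hP : P + h.mulI hI P = 0) :
    P = 0 ∨ P = h.origin := by
  rcases P with _ | ⟨x, y, hxy⟩
  · exact Or.inl rfl
  · by_cases hx : x = 0
    · exact Or.inr (h.ext_sq _ _ hx rfl)
    · obtain ⟨Y, hY, h1⟩ := h.exists_add_mulI_eq hI hxy hx
      exact (Point.some_ne_zero _ (h1.symm.trans hP)).elim

/-- The `x`-coordinate formula reduces division by `1 + i` to a quadratic equation in `x`, followed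
by a choice of sign for `y`. -/
lemma exists_add_mulI [IsAlgClosed F] (Q : W.toAffine.Point) : ∃ P, P + h.mulI hI P = Q := by
  have h2 := h.two_ne_zero
  have hI0 : (I : F) ≠ 0 := I.ne_zero
  rcases Q with _ | ⟨X, Y, hXY⟩
  · exact ⟨0, by rw [map_zero, add_zero]; rfl⟩
  -- Completing the square in `x ^ 2 + a = 2 * I * x * X` gives `(x - I * X) ^ 2 = -X ^ 2 - a`.
  · obtain ⟨d, hd⟩ := IsAlgClosed.exists_pow_nat_eq (-X ^ 2 - a) (n := 2) (by norm_num)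
    set x := I * X + d with hxd
    have hx : x ^ 2 + a = 2 * I * x * X := by
      linear_combination hd + (-X ^ 2) * hI
    have hx0 : x ≠ 0 := fun h0 ↦ h.ne_zero (by rw [h0] at hx; linear_combination hx)
    obtain ⟨y, hy⟩ := IsAlgClosed.exists_pow_nat_eq (x ^ 3 + a * x) (n := 2) (by norm_num)
    have hxy := h.nonsingular_iff.mpr hy
    obtain ⟨Y', hY', h1⟩ := h.exists_add_mulI_eq hI hxy hx0
    have hX : X = (x ^ 2 + a) / (2 * I * x) := by
      rw [hx]
      field_simp
    rcases (Point.X_eq_iff (h₁ := hXY) (h₂ := hY')).mp hX with h3 | h3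
    · exact ⟨_, h1.trans h3.symm⟩
    · exact ⟨-.some x y hxy, by rw [map_neg, ← neg_add, h1, h3]⟩

end IsQuartic

open GaussianModule in
/-- A Galois-equivariant homomorphism from the points of `y² = x³ + ix` to those of `y² = x³ - ix`
has infinite kernel. -/
theorem infinite_ker_of_equivariant [IsAlgClosed F] [DecidableEq F] {W W' : WeierstrassCurve F}
    {I : F} (hI : I ^ 2 = -1) (hW : IsQuartic I W) (hW' : IsQuartic (-I) W') {g : F →+* F}
    {ζ : F} (hζ : ζ ^ 2 = -I) (hgζ : g ζ = -ζ) (hg : IsScaling g 1 W W) (hg' : IsScaling g 1 W' W')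
    (φ : W.toAffine.Point →+ W'.toAffine.Point)
    (hφ : ∀ P, φ (hg.pointHom P) = hg'.pointHom (φ P)) :
    (φ.ker : Set W.toAffine.Point).Infinite := by
  have h2 := hW.two_ne_zero
  have hI0 : I ≠ 0 := hW.ne_zero
  have hζ0 : ζ ≠ 0 := fun h0 ↦ hI0 (by linear_combination hζ - ζ * h0)
  have hgI : g I = I := by
    have := hg.a₄
    simpa [hW.a₄] using this.symm
  obtain ⟨u, rfl⟩ : ∃ u : Fˣ, (u : F) = I := ⟨Units.mk0 I hI0, rfl⟩
  -- Scaling by `ζ` multiplies `a₄` by `ζ ^ 4 = -1`, which turns `-I` into `I`.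
  have hs : IsScaling (RingHom.id F) (Units.mk0 ζ hζ0) W' W := by
    constructor <;> simp only [hW.a₁, hW.a₂, hW.a₃, hW.a₄, hW.a₆, hW'.a₁, hW'.a₂, hW'.a₃, hW'.a₄,
      hW'.a₆, Units.val_mk0, RingHom.id_apply, mul_zero]
    linear_combination (u : F) * (ζ ^ 2 - u) * hζ + u * hI
  let : Module GaussianInt W.toAffine.Point := ofEnd (hW.mulI hI) (hW.mulI_mulI hI)
  have smul_def : ∀ (α : GaussianInt) (P : W.toAffine.Point),
    α • P = α.re • P + α.im • hW.mulI hI P := fun _ _ ↦ rfl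
  have lam_smul : ∀ P : W.toAffine.Point, lam • P = P + hW.mulI hI P := fun P ↦ by
    simp [smul_def]
  have I_smul : ∀ P : W.toAffine.Point, GaussianModule.I • P = hW.mulI hI P := fun P ↦ by
    simp [smul_def]
  have g_some : ∀ {x y} (hxy : W.toAffine.Nonsingular x y), ∃ hxy',
      hg.pointHom (.some x y hxy) = .some (g x) (g y) hxy' := by
    intro x y hxy
    have : W.toAffine.Nonsingular (g x) (g y) := by simpa using hg.nonsingular hxy
    exact ⟨this, by simp [IsScaling.pointHom_some]⟩
  have g_comm : ∀ P, hg.pointHom (hW.mulI hI P) = hW.mulI hI (hg.pointHom P) := by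
    rintro (_ | ⟨x, y, hxy⟩)
    · rfl
    · obtain ⟨h3, h4⟩ := g_some hxy
      obtain ⟨h5, h6⟩ := g_some (hW.nonsingular_mulI hI hxy)
      rw [h4, hW.mulI_some, hW.mulI_some, h6]
      simp [hgI]
  let gl : W.toAffine.Point →ₗ[GaussianInt] W.toAffine.Point :=
    { toFun := hg.pointHom
      map_add' := map_add _
      map_smul' := fun α P ↦ by
        simp only [smul_def, map_add, map_zsmul, g_comm, RingHom.id_apply] }
  have gl_apply : ∀ P, gl P = hg.pointHom P := fun _ ↦ rfl
  -- The twist: `g` fixes `ζ ^ 2` but negates `ζ ^ 3`, which changes the sign of the `y`-coordinate.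
  have g_anti : ∀ Q, hs.pointHom (hg'.pointHom Q) = -hg.pointHom (hs.pointHom Q) := by
    rintro (_ | ⟨x, y, hxy⟩)
    · rfl
    · simp only [IsScaling.pointHom_some, Point.neg_some, Point.some.injEq, hW.negY]
      simp only [Units.val_mk0, Units.val_one, one_pow, one_mul, RingHom.id_apply, map_mul, map_pow,
        hgζ]
      constructor <;> ring
  -- a point of exact order `(1 + i) ^ 4`
  set x₄ : F := 1 - u - ζ with hx₄
  have hx₄0 : x₄ ≠ 0 := by
    intro h0
    have h3 : ζ ^ 2 = (1 - u) ^ 2 := by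
      linear_combination (-(1 - u) - ζ) * h0
    exact hI0 (by linear_combination h3 - hζ + hI)
  obtain ⟨y₄, hy₄⟩ := IsAlgClosed.exists_pow_nat_eq (x₄ ^ 3 + u * x₄) (n := 2) (by norm_num)
  have hP₄ := hW.nonsingular_iff.mpr hy₄
  obtain ⟨y₃, hP₃, h₃⟩ := hW.exists_add_mulI_eq hI hP₄ hx₄0
  -- Repeated multiplication by `1 + i` moves the `x`-coordinate along `1 - u - ζ`, `u * ζ`, `ζ`,
  -- `0`.
  have hx₃ : (x₄ ^ 2 + u) / (2 * u * x₄) = u * ζ := by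
    rw [div_eq_iff (by simp [h2, hx₄0])]
    rw [hx₄]
    linear_combination (1 + 2 * u ^ 2) * hζ + (1 - 2 * ζ + 2 * u * ζ - 2 * u) * hI
  have hx₃0 : (u : F) * ζ ≠ 0 := mul_ne_zero hI0 hζ0
  simp only [hx₃] at hP₃ h₃
  obtain ⟨y₂, hP₂, h₂⟩ := hW.exists_add_mulI_eq hI hP₃ hx₃0
  have hx₂ : ((u * ζ) ^ 2 + u) / (2 * u * (u * ζ)) = ζ := by
    rw [div_eq_iff (by simp [h2, hζ0])]
    linear_combination (-u ^ 2) * hζ + u * hI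
  simp only [hx₂] at hP₂ h₂
  obtain ⟨y₁, hP₁, h₁⟩ := hW.exists_add_mulI_eq hI hP₂ hζ0
  have hx₁ : (ζ ^ 2 + u) / (2 * u * ζ) = 0 := by
    rw [hζ]
    simp
  set P₄ := Point.some x₄ y₄ hP₄ with hP₄_def
  have hlam1 : lam • P₄ = .some (u * ζ) y₃ hP₃ := by rw [lam_smul, h₃]
  have hlam2 : lam ^ 2 • P₄ = .some ζ y₂ hP₂ := by
    rw [pow_succ', mul_smul, pow_one, hlam1, lam_smul, h₂]
  have hlam3 : lam ^ 3 • P₄ = hW.origin := by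
    rw [pow_succ', mul_smul, hlam2, lam_smul, h₁]
    exact hW.ext_sq _ _ hx₁ rfl
  obtain ⟨hgP₄, hgP₄'⟩ := g_some hP₄
  obtain ⟨hgP₂, hgP₂'⟩ := g_some hP₂
  -- Both `I • P₄` and its negative have `x`-coordinate `-x₄`, so this one inequality excludes both.
  have hne : g x₄ ≠ -x₄ := by
    intro h0
    rw [hx₄, map_sub, map_sub, map_one, hgI, hgζ] at h0
    have h3 : 2 * (1 - (u : F)) = 0 := by linear_combination h0
    have h4 : (1 - (u : F)) = 0 := (mul_eq_zero.mp h3).resolve_left h2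
    exact h2 (by linear_combination (u + 1) * h4 + hI)
  have vanish := eq_zero_of_anticommute (T := hW.origin)
    (fun P hP ↦ hW.eq_zero_or_eq_origin_of_add_mulI hI P (by rwa [lam_smul] at hP))
    (by rw [lam_smul, hW.origin_add_mulI]) hW.origin_ne_zero
    (fun Q ↦ by simpa only [lam_smul] using hW.exists_add_mulI hI Q)
    gl hg.pointHom_injective hlam3
    (by
      rw [gl_apply, hlam2, hgP₂', ne_eq, Point.some.injEq, hgζ]
      rintro ⟨h0, -⟩
      exact mul_ne_zero h2 hζ0 (by linear_combination -h0))
    (by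
      rw [gl_apply, I_smul, hgP₄', hP₄_def, hW.mulI_some, ne_eq, Point.some.injEq]
      exact fun h0 ↦ hne h0.1)
    (by
      rw [gl_apply, I_smul, hgP₄', hP₄_def, hW.mulI_some, Point.neg_some, ne_eq, Point.some.injEq]
      exact fun h0 ↦ hne h0.1)
    (hs.pointHom.comp φ)
    (fun Q ↦ by
      change hs.pointHom (φ (hg.pointHom Q)) = -hg.pointHom (hs.pointHom (φ Q))
      rw [hφ, g_anti])
  refine (infinite_torsion (T := hW.origin) (by rw [lam_smul, hW.origin_add_mulI]) hW.origin_ne_zero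
    (fun Q ↦ by simpa only [lam_smul] using hW.exists_add_mulI hI Q)).mono ?_
  rintro R ⟨n, hR⟩
  have := vanish n R hR
  rw [SetLike.mem_coe, AddMonoidHom.mem_ker]
  exact hs.pointHom_injective (this.trans (map_zero _).symm)

end WeierstrassCurve.Affine

end

/-! ### Galois equivariance of morphisms and the absence of an isogeny. -/

noncomputable section

namespace EllipticIsogeny

open WeierstrassCurve.Affine

variable {K : Type*} [Field K]

/-- A point is determined by its homogeneous coordinates up to scaling. -/
lemma eq_of_smul_homCoord_eq {F : Type*} [Field F] {W : WeierstrassCurve F}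
    {P Q : W.toAffine.Point} {c d : F} (hc : c • homCoord P ≠ 0)
    (h : c • homCoord P = d • homCoord Q) : P = Q := by
  have hc0 : c ≠ 0 := fun h0 ↦ hc (by rw [h0, zero_smul])
  have hd0 : d ≠ 0 := fun h0 ↦ hc (by rw [h, h0, zero_smul])
  have h0 := congrFun h 0
  have h1 := congrFun h 1
  have h2 := congrFun h 2
  rcases P with _ | ⟨x, y, hP⟩ <;> rcases Q with _ | ⟨x', y', hQ⟩ <;>
    simp only [homCoord, Pi.smul_apply, Matrix.cons_val_zero, Matrix.cons_val_one, Matrix.cons_val,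
      smul_eq_mul, mul_one, mul_zero] at h0 h1 h2
  · rfl
  · exact (hd0 h2.symm).elim
  · exact (hc0 h2).elim
  · subst h2
    simp only [Point.some.injEq]
    exact ⟨mul_left_cancel₀ hc0 h0, mul_left_cancel₀ hc0 h1⟩

lemma isScaling_galois (E : WeierstrassCurve K)
    (g : AlgebraicClosure K →ₐ[K] AlgebraicClosure K) :
    IsScaling (g : AlgebraicClosure K →+* AlgebraicClosure K) 1
      (E.baseChange (AlgebraicClosure K)) (E.baseChange (AlgebraicClosure K)) := by
  constructor <;> simp [WeierstrassCurve.baseChange]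

open scoped Classical in
lemma homCoord_galois (E : WeierstrassCurve K)
    (g : AlgebraicClosure K →ₐ[K] AlgebraicClosure K) (P : GeomPoint E) (j : Fin 3) :
    homCoord ((isScaling_galois E g).pointHom P) j = g (homCoord P j) := by
  rcases P with _ | ⟨x, y, h⟩
  · change homCoord (WeierstrassCurve.Affine.Point.zero) j = _
    fin_cases j <;> simp [homCoord]
  · rw [IsScaling.pointHom_some]
    fin_cases j <;> simp [homCoord]

open scoped Classical in
lemma evalForms_galois (E : WeierstrassCurve K)
    (g : AlgebraicClosure K →ₐ[K] AlgebraicClosure K) (F : Fin 3 → MvPolynomial (Fin 3) K)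
    (P : GeomPoint E) (j : Fin 3) :
    evalForms F ((isScaling_galois E g).pointHom P) j = g (evalForms F P j) := by
  simp only [evalForms]
  have h : homCoord ((isScaling_galois E g).pointHom P) = g ∘ homCoord P :=
    funext (homCoord_galois E g P)
  rw [h, MvPolynomial.comp_aeval_apply]
  rfl

open scoped Classical in
/-- A morphism defined over `K` commutes with the Galois action on geometric points. -/
theorem IsMorphismOver.map_galois {E E' : WeierstrassCurve K} {φ : GeomPoint E → GeomPoint E'}
    (hφ : IsMorphismOver φ) (g : AlgebraicClosure K →ₐ[K] AlgebraicClosure K) (P : GeomPoint E) :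
    φ ((isScaling_galois E g).pointHom P) = (isScaling_galois E' g).pointHom (φ P) := by
  obtain ⟨d, F, -, hP, hF⟩ := hφ P
  -- The forms have coefficients in `K`, so those that compute `φ` at `P` are nonvanishing at the
  -- conjugate point too and compute `φ` there.
  have hg : evalForms F ((isScaling_galois E g).pointHom P) ≠ 0 := by
    obtain ⟨j, hj⟩ := Function.ne_iff.mp hP
    refine Function.ne_iff.mpr ⟨j, ?_⟩
    rw [evalForms_galois]
    exact (map_ne_zero g).mpr hj
  obtain ⟨c, hc⟩ := hF _ hg
  obtain ⟨c', hc'⟩ := hF _ hP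
  apply eq_of_smul_homCoord_eq (c := c) (d := g c') (hc ▸ hg)
  rw [← hc]
  funext j
  rw [evalForms_galois, hc', Pi.smul_apply, Pi.smul_apply, smul_eq_mul, smul_eq_mul, map_mul,
    homCoord_galois]

end EllipticIsogeny

namespace GaussianField

open EllipticIsogeny WeierstrassCurve.Affine

lemma exists_eq_add_mul_i (x : QI) : ∃ a b : ℚ, x = a + b * i := by
  obtain ⟨f, hf⟩ :=
    (IntermediateField.adjoin.powerBasis (K := ℚ) isIntegral_complex_I).exists_eq_aeval' x
  replace hf : x = Polynomial.aeval i f := hf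
  have hmonic : (Polynomial.X ^ 2 + 1 : Polynomial ℚ).Monic := by monicity!
  have hroot : Polynomial.aeval i (Polynomial.X ^ 2 + 1 : Polynomial ℚ) = 0 := by simp [i_sq]
  have hdeg : (f %ₘ (Polynomial.X ^ 2 + 1)).natDegree ≤ 1 := by
    have h1 : (Polynomial.X ^ 2 + 1 : Polynomial ℚ).natDegree = 2 := by compute_degree!
    have h2 := Polynomial.natDegree_modByMonic_lt f hmonic (fun h ↦ by simp [h] at h1)
    lia
  obtain ⟨b, a, hab⟩ := Polynomial.exists_eq_X_add_C_of_natDegree_le_one hdeg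
  refine ⟨a, b, ?_⟩
  rw [hf, ← Polynomial.aeval_modByMonic_eq_self_of_root hroot, hab]
  simp [add_comm]

/-- From `(a + b i)² = -i` one gets `a² = b²` and `2ab = -1`: if `a = b` then `2a² = -1`, and if `a
= -b` then `(2a)² = 2`, both impossible in `ℚ`. -/
lemma not_isSquare_neg_i (x : QI) : x ^ 2 ≠ -i := by
  intro hx
  obtain ⟨a, b, rfl⟩ := exists_eq_add_mul_i x
  have h1 := congrArg (fun z : QI ↦ (z : ℂ).re) hx
  have h2 := congrArg (fun z : QI ↦ (z : ℂ).im) hx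
  simp [i, pow_two] at h1 h2
  have h1' : a * a - b * b = 0 := by exact_mod_cast h1
  have h2' : a * b + b * a = -1 := by
    apply Rat.cast_injective (α := ℝ)
    push_cast
    exact h2
  have h3 : (a - b) * (a + b) = 0 := by linear_combination h1'
  rcases mul_eq_zero.mp h3 with h3 | h3
  · rw [sub_eq_zero] at h3
    subst h3
    nlinarith [sq_nonneg a]
  · have h4 : IsSquare ((2 : ℕ) : ℚ) := ⟨2 * a, by
      push_cast
      linear_combination (-4 * a) * h3 + 2 * h2'⟩
    rw [Rat.isSquare_natCast_iff] at h4
    exact Nat.prime_two.prime.irreducible.not_isSquare h4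

theorem not_isogenous {σ : QI →+* QI} (hσ : σ i = -i) : ¬ Isogenous E (E.map σ) := by
  classical
  rintro ⟨φ, hφ⟩
  set F := AlgebraicClosure QI
  obtain ⟨ζ, hζ⟩ := IsAlgClosed.exists_pow_nat_eq (algebraMap QI F (-i)) (n := 2) (by norm_num)
  have hI : (algebraMap QI F i) ^ 2 = -1 := by rw [← map_pow, i_sq, map_neg, map_one]
  have hi0 : i ≠ 0 := fun h0 ↦ by simpa [h0] using i_sq
  -- As `-i` is not a square in `ℚ(i)`, the root `ζ` is not rational over the base and some Galois
  -- automorphism moves it.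
  obtain ⟨g, hg⟩ : ∃ g : F ≃ₐ[QI] F, g ζ ≠ ζ := by
    by_contra! hfix
    obtain ⟨x, hx⟩ := (InfiniteGalois.mem_range_algebraMap_iff_fixed ζ).mpr hfix
    apply not_isSquare_neg_i x
    apply (algebraMap QI F).injective
    rw [map_pow, hx, hζ]
  have hgζ : g ζ = -ζ := by
    have : (g ζ) ^ 2 = ζ ^ 2 := by rw [← map_pow, hζ, AlgEquiv.commutes]
    exact (sq_eq_sq_iff_eq_or_eq_neg.mp this).resolve_left hg
  have hW : IsQuartic (algebraMap QI F i) (E.baseChange F) := by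
    constructor <;> simp [WeierstrassCurve.baseChange, E, hi0]
  have hW' : IsQuartic (-algebraMap QI F i) ((E.map σ).baseChange F) := by
    constructor <;> simp [WeierstrassCurve.baseChange, E, hi0, hσ]
  refine infinite_ker_of_equivariant hI hW hW' (by rw [hζ, map_neg]) hgζ
    (isScaling_galois E (g : F →ₐ[QI] F)) (isScaling_galois (E.map σ) (g : F →ₐ[QI] F)) φ
    (fun P ↦ ?_) ?_
  · convert hφ.morphism.map_galois (g : F →ₐ[QI] F) P
  · convert hφ.finite_ker

end GaussianField

end

/-! ### Point counts under changes of variables and field isomorphisms. -/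

noncomputable section

namespace WeierstrassCurve

section Points

variable {F : Type*} [Field F]

/-- The equation is rescaled by `u⁻⁶`, and by the chain rule the partial derivatives `A`, `B` become
`u⁻⁴ (A + s B)` and `u⁻³ B`, an invertible triangular substitution. -/
lemma nonsingular_variableChange_iff (C : VariableChange F) (W : WeierstrassCurve F) (x y : F) :
    (C • W).toAffine.Nonsingular x y ↔
      W.toAffine.Nonsingular (C.u ^ 2 * x + C.r) (C.u ^ 3 * y + C.u ^ 2 * C.s * x + C.t) := by
  obtain ⟨u, r, s, t⟩ := C
  have hu : (u : F) ≠ 0 := u.ne_zero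
  rw [Affine.nonsingular_iff', Affine.nonsingular_iff', Affine.equation_iff', Affine.equation_iff']
  simp only [variableChange_a₁, variableChange_a₂, variableChange_a₃, variableChange_a₄,
    variableChange_a₆, Units.val_inv_eq_inv_val]
  set A := W.a₁ * (u ^ 3 * y + u ^ 2 * s * x + t) - (3 * (u ^ 2 * x + r) ^ 2 +
    2 * W.a₂ * (u ^ 2 * x + r) + W.a₄) with hA
  set B := 2 * (u ^ 3 * y + u ^ 2 * s * x + t) + W.a₁ * (u ^ 2 * x + r) + W.a₃ with hB
  have h1 : (u⁻¹ : F) * (W.a₁ + 2 * s) * y - (3 * x ^ 2 + 2 * ((u⁻¹ : F) ^ 2 *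
      (W.a₂ - s * W.a₁ + 3 * r - s ^ 2)) * x + (u⁻¹ : F) ^ 4 * (W.a₄ - s * W.a₃ + 2 * r * W.a₂ -
      (t + r * s) * W.a₁ + 3 * r ^ 2 - 2 * s * t)) = (u⁻¹ : F) ^ 4 * (A + s * B) := by
    rw [hA, hB]
    field_simp
    ring
  have h2 : 2 * y + (u⁻¹ : F) * (W.a₁ + 2 * s) * x + (u⁻¹ : F) ^ 3 * (W.a₃ + r * W.a₁ + 2 * t) =
      (u⁻¹ : F) ^ 3 * B := by
    rw [hB]
    field_simp
    ring
  rw [h1, h2]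
  refine and_congr ?_ ?_
  · rw [← mul_right_inj' (pow_ne_zero 6 hu), mul_zero]
    refine Eq.congr_left ?_
    field_simp
    ring
  · rw [← not_iff_not]
    simp only [ne_eq, not_or, not_not, mul_eq_zero, pow_eq_zero_iff, inv_eq_zero, hu, false_or,
      OfNat.ofNat_ne_zero, not_false_eq_true]
    constructor
    · rintro ⟨h3, h4⟩
      exact ⟨by simpa [h4] using h3, h4⟩
    · rintro ⟨h3, h4⟩
      exact ⟨by simp [h3, h4], h4⟩

/-- A change of variables induces a bijection of points. -/
lemma card_point_variableChange (C : VariableChange F) (W : WeierstrassCurve F) :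
    Nat.card (C • W).toAffine.Point = Nat.card W.toAffine.Point := by
  have hu : (C.u : F) ≠ 0 := C.u.ne_zero
  let f : (C • W).toAffine.Point → W.toAffine.Point
    | .zero => .zero
    | .some x y h => .some _ _ ((nonsingular_variableChange_iff C W x y).mp h)
  refine Nat.card_congr (Equiv.ofBijective f ⟨?_, ?_⟩)
  · rintro (_ | ⟨x, y, h⟩) (_ | ⟨x', y', h'⟩) hf
    · rfl
    · cases hf
    · cases hf
    · simp only [f, Affine.Point.some.injEq] at hf
      obtain ⟨h1, h2⟩ := hf
      have hx : x = x' := by simpa [hu] using h1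
      subst hx
      have hy : y = y' := by simpa [hu] using h2
      subst hy
      rfl
  · rintro (_ | ⟨X, Y, h⟩)
    · exact ⟨.zero, rfl⟩
    · have hX : (C.u : F) ^ 2 * ((C.u : F)⁻¹ ^ 2 * (X - C.r)) + C.r = X := by
        field_simp
        ring
      have hY : (C.u : F) ^ 3 * ((C.u : F)⁻¹ ^ 3 * (Y - C.s * (X - C.r) - C.t)) +
          C.u ^ 2 * C.s * ((C.u : F)⁻¹ ^ 2 * (X - C.r)) + C.t = Y := by
        field_simp
        ring
      refine ⟨.some ((C.u : F)⁻¹ ^ 2 * (X - C.r)) ((C.u : F)⁻¹ ^ 3 * (Y - C.s * (X - C.r) - C.t))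
        ((nonsingular_variableChange_iff C W _ _).mpr (by rwa [hX, hY])), ?_⟩
      simp only [f, Affine.Point.some.injEq]
      exact ⟨hX, hY⟩

lemma card_point_map {F' : Type*} [Field F'] (e : F ≃+* F') (W : WeierstrassCurve F) :
    Nat.card (W.map (e : F →+* F')).toAffine.Point = Nat.card W.toAffine.Point := by
  let f : W.toAffine.Point → (W.map (e : F →+* F')).toAffine.Point
    | .zero => .zero
    | .some x y h => .some _ _
        ((W.toAffine.map_nonsingular (f := (e : F →+* F')) e.injective x y).mpr h)
  refine (Nat.card_congr (Equiv.ofBijective f ⟨?_, ?_⟩)).symm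
  · rintro (_ | ⟨x, y, h⟩) (_ | ⟨x', y', h'⟩) hf
    · rfl
    · cases hf
    · cases hf
    · simp only [f, Affine.Point.some.injEq] at hf
      simpa using hf
  · rintro (_ | ⟨X, Y, h⟩)
    · exact ⟨.zero, rfl⟩
    · obtain ⟨x, rfl⟩ := e.surjective X
      obtain ⟨y, rfl⟩ := e.surjective Y
      exact ⟨.some x y
        ((W.toAffine.map_nonsingular (f := (e : F →+* F')) e.injective x y).mp h), rfl⟩

end Points

end WeierstrassCurve

end

/-! ### Minimal equations over a discrete valuation ring and their uniqueness. -/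

noncomputable section

namespace WeierstrassCurve

section Valuation

variable {R K : Type*} [CommRing R] [IsDomain R] [IsDiscreteValuationRing R] [Field K] [Algebra R K]
  [IsFractionRing R K]

open IsDiscreteValuationRing

lemma valuation_le_iff {x y : K} :
    (maximalIdeal R).valuation K x ≤ (maximalIdeal R).valuation K y ↔
      ∃ r : R, x = algebraMap R K r * y := by
  constructor
  · intro h
    by_cases hy : y = 0
    · subst hy
      rw [map_zero, le_zero_iff, map_eq_zero] at h
      exact ⟨0, by simp [h]⟩
    · obtain ⟨r, hr⟩ := exists_lift_of_le_one (A := R) (x := x / y) (by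
        rw [map_div₀]
        exact div_le_one_of_le₀ h zero_le)
      exact ⟨r, by rw [hr, div_mul_cancel₀ _ hy]⟩
  · rintro ⟨r, rfl⟩
    rw [map_mul]
    exact mul_le_of_le_one_left' (HeightOneSpectrum.valuation_le_one _ r)

/-- Divisibility of discriminants transports along ring isomorphisms without any comparison of
valuations. The value group is totally ordered, so maximality is a plain inequality. -/
lemma isMinimal_iff_dvd {W : WeierstrassCurve K} :
    IsMinimal R W ↔ IsIntegral R W ∧ ∀ C : VariableChange K, IsIntegral R (C • W) →
      ∃ r : R, (C • W).Δ = algebraMap R K r * W.Δ := by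
  rw [isMinimal_iff, MaximalFor, one_smul]
  refine and_congr_right fun hW ↦ forall_congr' fun C ↦ forall_congr' fun hC ↦ ?_
  rw [← valuation_le_iff, ← valuation_Δ_aux_eq_of_isIntegral, ← valuation_Δ_aux_eq_of_isIntegral,
    Subtype.coe_le_coe]
  exact ⟨fun h ↦ (le_total _ _).elim h id, fun h _ ↦ h⟩

lemma hasGoodReduction_iff_dvd {W : WeierstrassCurve K} [hW : IsMinimal R W] :
    HasGoodReduction R W ↔ ∃ r : R, 1 = algebraMap R K r * W.Δ := by
  rw [hasGoodReduction_iff, and_iff_right hW, ← valuation_le_iff, map_one]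
  obtain ⟨r, hr⟩ := Δ_integral_of_isIntegral R W
  have : (maximalIdeal R).valuation K W.Δ ≤ 1 := hr ▸ HeightOneSpectrum.valuation_le_one _ r
  exact ⟨fun h ↦ h.ge, fun h ↦ le_antisymm this h⟩

/-- An integral equation with unit discriminant is minimal. -/
lemma isMinimal_of_isUnit_Δ {W : WeierstrassCurve K} [IsIntegral R W]
    (hΔ : ∃ r : R, 1 = algebraMap R K r * W.Δ) : IsMinimal R W := by
  obtain ⟨r, hr⟩ := hΔ
  refine isMinimal_iff_dvd.mpr ⟨inferInstance, fun C hC ↦ ?_⟩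
  obtain ⟨d, hd⟩ := Δ_integral_of_isIntegral R (C • W)
  exact ⟨d * r, by rw [map_mul, mul_assoc, ← hr, hd, mul_one]⟩

/-- Multiplicative reduction would make `c₄` a unit and `Δ` a nonunit, against `c₄ ^ 3 = 1728 * Δ`.
-/
lemma not_hasMultiplicativeReduction_of_c₄_pow {W : WeierstrassCurve K}
    (h : W.c₄ ^ 3 = 1728 * W.Δ) : ¬ W.HasMultiplicativeReduction R := by
  intro hm
  have h1 := congrArg ((maximalIdeal R).valuation K) h
  rw [map_pow, hm.multiplicativeReduction, one_pow, map_mul] at h1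
  have h2 : (maximalIdeal R).valuation K 1728 ≤ 1 := by
    rw [← map_ofNat (algebraMap R K) 1728]
    exact HeightOneSpectrum.valuation_le_one _ _
  exact ((mul_le_of_le_one_left' h2).trans_lt hm.badReduction).ne h1.symm

lemma c₄_pow_minimal {W : WeierstrassCurve K} (h : W.c₄ ^ 3 = 1728 * W.Δ) :
    (W.minimal R).c₄ ^ 3 = 1728 * (W.minimal R).Δ := by
  rw [minimal, variableChange_c₄, variableChange_Δ, Units.val_inv_eq_inv_val]
  linear_combination ((W.exists_isMinimal R).choose.u : K)⁻¹ ^ 12 * h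

end Valuation

section Unique

variable {R K : Type*} [CommRing R] [IsDomain R] [IsDiscreteValuationRing R] [Field K] [Algebra R K]
  [IsFractionRing R K]

lemma exists_algebraMap_eq_of_monic {x : K} {p : Polynomial R}
    (hp : p.Monic) (hx : Polynomial.aeval x p = 0) : ∃ r : R, algebraMap R K r = x :=
  IsIntegrallyClosed.isIntegral_iff.mp ⟨p, hp, hx⟩

/-- A change of variables between integral equations, with scaling factor a unit, is integral. -/
lemma exists_map_eq_of_isIntegral {M : WeierstrassCurve K} {C : VariableChange K}
    [IsIntegral R M] [IsIntegral R (C • M)] {w : Rˣ} (hw : algebraMap R K w = C.u) :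
    ∃ D : VariableChange R, D.map (algebraMap R K) = C := by
  obtain ⟨A, rfl⟩ := IsIntegral.integral (R := R) (W := M)
  obtain ⟨B, hB⟩ := IsIntegral.integral (R := R) (W := C • A.baseChange K)
  have hu : (C.u : K) ≠ 0 := C.u.ne_zero
  have hb₆ := congrArg WeierstrassCurve.b₆ hB
  have hb₈ := congrArg WeierstrassCurve.b₈ hB
  have ha₂ := congrArg WeierstrassCurve.a₂ hB
  have ha₆ := congrArg WeierstrassCurve.a₆ hB
  simp only [variableChange_b₆, variableChange_b₈, variableChange_a₂, variableChange_a₆, baseChange,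
    map_b₂, map_b₄, map_b₆, map_b₈, map_a₁, map_a₂, map_a₃, map_a₄, map_a₆,
    Units.val_inv_eq_inv_val] at hb₆ hb₈ ha₂ ha₆
  set f := algebraMap R K with hf
  have hr6 : 4 * C.r ^ 3 + f A.b₂ * C.r ^ 2 + 2 * f A.b₄ * C.r +
      (f A.b₆ - f (w ^ 6) * f B.b₆) = 0 := by
    rw [← hb₆, map_pow, hw]
    field_simp
    ring
  have hr8 : 3 * C.r ^ 4 + f A.b₂ * C.r ^ 3 + 3 * f A.b₄ * C.r ^ 2 + 3 * f A.b₆ * C.r +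
      (f A.b₈ - f (w ^ 8) * f B.b₈) = 0 := by
    rw [← hb₈, map_pow, hw]
    field_simp
    ring
  -- The formulas for `b₆` and `b₈` make `C.r` a root of polynomials with leading coefficients `4`
  -- and `3`. Since `4 - 3 = 1`, one of these is a unit of the local ring, and `C.r` is integral
  -- over `R`.
  obtain ⟨r, hr⟩ : ∃ r : R, f r = C.r := by
    rcases IsLocalRing.isUnit_or_isUnit_of_isUnit_add (a := (4 : R)) (b := -3)
      (by norm_num) with h | h
    · obtain ⟨c, hc⟩ := h.exists_left_inv
      have hc' : f c * 4 = 1 := by rw [← map_ofNat f, ← map_mul, hc, map_one]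
      apply exists_algebraMap_eq_of_monic (p := Polynomial.X ^ 3 +
        Polynomial.C (c * A.b₂) * Polynomial.X ^ 2 + Polynomial.C (c * (2 * A.b₄)) * Polynomial.X +
        Polynomial.C (c * (A.b₆ - w ^ 6 * B.b₆)))
      · monicity!
      · simp only [map_add, map_mul, map_pow, map_sub, map_ofNat, Polynomial.aeval_X,
          Polynomial.aeval_C]
        simp only [map_pow] at hr6
        linear_combination f c * hr6 - C.r ^ 3 * hc'
    · obtain ⟨c, hc⟩ := h.exists_left_inv
      have hc' : f c * 3 = -1 := by
        rw [← map_ofNat f, ← map_mul, ← map_one f, ← map_neg]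
        congr 1
        linear_combination -hc
      apply exists_algebraMap_eq_of_monic (p := Polynomial.X ^ 4 -
        Polynomial.C (c * A.b₂) * Polynomial.X ^ 3 -
        Polynomial.C (c * (3 * A.b₄)) * Polynomial.X ^ 2 -
        Polynomial.C (c * (3 * A.b₆)) * Polynomial.X - Polynomial.C (c * (A.b₈ - w ^ 8 * B.b₈)))
      · monicity!
      · simp only [map_mul, map_pow, map_sub, map_ofNat, Polynomial.aeval_X, Polynomial.aeval_C]
        simp only [map_pow] at hr8
        linear_combination -f c * hr8 + C.r ^ 4 * hc'
  -- With `r` integral, the formulas for `a₂` and `a₆` are monic quadratic equations for `s` and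
  -- `t`.
  obtain ⟨s, hs⟩ : ∃ s : R, f s = C.s := by
    apply exists_algebraMap_eq_of_monic (p := Polynomial.X ^ 2 + Polynomial.C A.a₁ * Polynomial.X +
      Polynomial.C (w ^ 2 * B.a₂ - A.a₂ - 3 * r))
    · monicity!
    · simp only [map_add, map_mul, map_pow, map_sub, map_ofNat, Polynomial.aeval_X,
        Polynomial.aeval_C]
      rw [← hf, ← ha₂, hw, hr]
      field_simp
      ring
  obtain ⟨t, ht⟩ : ∃ t : R, f t = C.t := by
    apply exists_algebraMap_eq_of_monic (p := Polynomial.X ^ 2 +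
      Polynomial.C (A.a₃ + r * A.a₁) * Polynomial.X +
      Polynomial.C (w ^ 6 * B.a₆ - A.a₆ - r * A.a₄ - r ^ 2 * A.a₂ - r ^ 3))
    · monicity!
    · simp only [map_add, map_mul, map_pow, map_sub, Polynomial.aeval_X, Polynomial.aeval_C]
      rw [← hf, ← ha₆, hw, hr]
      field_simp
      ring
  refine ⟨⟨w, r, s, t⟩, ?_⟩
  ext <;> simp [VariableChange.map, hr, hs, ht, hw]

/-- Two minimal equations of a curve are related by an integral change of variables. -/
theorem exists_integralModel_eq_smul {M N : WeierstrassCurve K} [IsMinimal R M] [IsMinimal R N]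
    (hM : M.Δ ≠ 0) {C : VariableChange K} (hC : N = C • M) :
    ∃ D : VariableChange R, integralModel R N = D • integralModel R M := by
  -- Minimality of both equations makes `u ^ 12` and its inverse integral, so `u` is a unit of `R`
  -- by integral closedness.
  obtain ⟨r, hr⟩ := (isMinimal_iff_dvd.mp ‹IsMinimal R M›).2 C (hC ▸ inferInstance)
  obtain ⟨s, hs⟩ := (isMinimal_iff_dvd.mp ‹IsMinimal R N›).2 C⁻¹ (by
    rw [hC, inv_smul_smul]
    infer_instance)
  subst hC
  rw [inv_smul_smul] at hs
  have hu : (C.u : K) ≠ 0 := C.u.ne_zero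
  have hr' : algebraMap R K r = (C.u⁻¹ : K) ^ 12 := by
    rw [variableChange_Δ, Units.val_inv_eq_inv_val] at hr
    exact (mul_right_cancel₀ hM hr).symm
  have hs' : algebraMap R K s = (C.u : K) ^ 12 := by
    rw [variableChange_Δ, Units.val_inv_eq_inv_val, ← mul_assoc] at hs
    have h1 : 1 * M.Δ = _ := (one_mul _).trans hs
    have h2 := mul_right_cancel₀ hM h1
    field_simp at h2
    exact h2.symm
  obtain ⟨w, hw⟩ : ∃ w : R, algebraMap R K w = C.u := by
    apply exists_algebraMap_eq_of_monic (p := Polynomial.X ^ 12 - Polynomial.C s)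
    · exact Polynomial.monic_X_pow_sub_C s (by norm_num)
    · simp [hs']
  have hw' : IsUnit w := by
    have h1 : w ^ 12 * r = 1 := by
      apply IsFractionRing.injective R K
      rw [map_mul, map_pow, hw, hr', map_one]
      field_simp
    exact (isUnit_pow_iff (by norm_num)).mp (IsUnit.of_mul_eq_one _ h1)
  obtain ⟨w, rfl⟩ := hw'
  obtain ⟨D, hD⟩ := exists_map_eq_of_isIntegral (R := R) (M := M) hw
  refine ⟨D, ?_⟩
  apply map_injective (IsFractionRing.injective R K)
  change (integralModel R (C • M)).baseChange K = (D • integralModel R M).map (algebraMap R K)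
  rw [baseChange_integralModel_eq, ← map_variableChange, hD]
  congr 1
  exact (baseChange_integralModel_eq R M).symm

end Unique

end WeierstrassCurve

end

/-! ### Invariance of reduction data under isomorphisms of the base. -/

noncomputable section

namespace WeierstrassCurve

section Transport

variable {R K R' K' : Type*} [CommRing R] [Field K] [Algebra R K] [CommRing R'] [Field K']
  [Algebra R' K']

lemma IsIntegral.map_of_comp_eq {e : R →+* R'} {f : K →+* K'}
    (hf : ∀ r, f (algebraMap R K r) = algebraMap R' K' (e r)) (W : WeierstrassCurve K)
    [IsIntegral R W] : IsIntegral R' (W.map f) := by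
  obtain ⟨A, rfl⟩ := IsIntegral.integral (R := R) (W := W)
  refine ⟨A.map e, ?_⟩
  ext <;> simp [baseChange, hf]

variable {e : R ≃+* R'} {f : K ≃+* K'} (hf : ∀ r, f (algebraMap R K r) = algebraMap R' K' (e r))

include hf

lemma isIntegral_map_iff {W : WeierstrassCurve K} :
    IsIntegral R' (W.map (f : K →+* K')) ↔ IsIntegral R W := by
  refine ⟨fun h ↦ ?_, fun h ↦ IsIntegral.map_of_comp_eq (e := (e : R →+* R')) hf W⟩
  have hf' : ∀ r, f.symm (algebraMap R' K' r) = algebraMap R K (e.symm r) := fun r ↦ by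
    rw [RingEquiv.symm_apply_eq, hf, RingEquiv.apply_symm_apply]
  have := IsIntegral.map_of_comp_eq (e := (e.symm : R' →+* R)) (f := (f.symm : K' →+* K)) hf'
    (W.map (f : K →+* K'))
  rwa [map_map, RingEquiv.symm_comp, map_id] at this

lemma integralModel_map [IsFractionRing R' K'] (W : WeierstrassCurve K) [IsIntegral R W]
    [IsIntegral R' (W.map (f : K →+* K'))] :
    integralModel R' (W.map (f : K →+* K')) = (integralModel R W).map (e : R →+* R') := by
  apply map_injective (IsFractionRing.injective R' K')
  change (integralModel R' _).baseChange K' = ((integralModel R W).map _).map _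
  rw [baseChange_integralModel_eq, map_map]
  conv_lhs => rw [← baseChange_integralModel_eq R W]
  rw [baseChange, map_map]
  congr 1
  ext r
  exact hf r

variable [IsDomain R] [IsDiscreteValuationRing R] [IsFractionRing R K]
  [IsDomain R'] [IsDiscreteValuationRing R'] [IsFractionRing R' K']

lemma IsMinimal.map (W : WeierstrassCurve K) [hW : IsMinimal R W] :
    IsMinimal R' (W.map (f : K →+* K')) := by
  rw [isMinimal_iff_dvd] at hW ⊢
  refine ⟨(isIntegral_map_iff hf).mpr hW.1, fun C hC ↦ ?_⟩
  have hC' : C = (C.map (f.symm : K' →+* K)).map (f : K →+* K') := by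
    rw [VariableChange.map_map, RingEquiv.comp_symm, VariableChange.map_id]
  rw [hC', map_variableChange] at hC ⊢
  obtain ⟨r, hr⟩ := hW.2 _ ((isIntegral_map_iff hf).mp hC)
  refine ⟨e r, ?_⟩
  rw [map_Δ, hr, map_mul, map_Δ]
  congr 1
  exact hf r

/-- The reduction type and the number of points of the reduction may be computed on any minimal
equation, and they are invariant under isomorphisms of the base. -/
theorem minimal_reduction_invariant (M : WeierstrassCurve K) [IsMinimal R M] (hM : M.Δ ≠ 0)
    {W' : WeierstrassCurve K'} {C : VariableChange K'} (hW' : W' = C • M.map (f : K →+* K')) :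
    ((W'.minimal R').HasGoodReduction R' ↔ M.HasGoodReduction R) ∧
    Nat.card ((W'.minimal R').reduction R').toAffine.Point =
      Nat.card (M.reduction R).toAffine.Point := by
  have hmin : IsMinimal R' (M.map (f : K →+* K')) := IsMinimal.map hf M
  have hint : IsIntegral R' (M.map (f : K →+* K')) := inferInstance
  have hΔ : (M.map (f : K →+* K')).Δ ≠ 0 := by
    rw [map_Δ]
    exact (map_ne_zero_iff _ f.injective).mpr hM
  -- `W'.minimal R'` rests on a choice, so it is comparable with the image of `M` only up to a
  -- change of variables; uniqueness of minimal equations makes that change integral.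
  have hN : W'.minimal R' = ((W'.exists_isMinimal R').choose * C) • M.map (f : K →+* K') := by
    rw [mul_smul, ← hW']
    rfl
  obtain ⟨D, hD⟩ := exists_integralModel_eq_smul (R := R') hΔ hN
  rw [integralModel_map hf] at hD
  constructor
  · rw [hasGoodReduction_iff_isElliptic_reduction, hasGoodReduction_iff_isElliptic_reduction,
      reduction, hD, ← map_variableChange, reduction, isElliptic_iff, isElliptic_iff,
      variableChange_Δ, map_Δ, map_Δ, map_Δ]
    rw [← Units.val_pow_eq_pow_val, Units.isUnit_units_mul]
    rw [isUnit_map_iff, isUnit_map_iff, isUnit_map_iff]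
  · rw [reduction, hD, ← map_variableChange, card_point_variableChange, reduction,
      ← card_point_map (IsLocalRing.ResidueField.mapEquiv e), map_map, map_map]
    rfl

lemma minimal_map_invariant {W : WeierstrassCurve K} (hW : W.Δ ≠ 0) {W' : WeierstrassCurve K'}
    (hW' : W' = W.map (f : K →+* K')) :
    ((W'.minimal R').HasGoodReduction R' ↔ (W.minimal R).HasGoodReduction R) ∧
    Nat.card ((W'.minimal R').reduction R').toAffine.Point =
      Nat.card ((W.minimal R).reduction R).toAffine.Point := by
  have hΔ : (W.minimal R).Δ ≠ 0 := by
    rw [minimal, variableChange_Δ]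
    exact mul_ne_zero (pow_ne_zero _ (Units.ne_zero _)) hW
  refine minimal_reduction_invariant hf (W.minimal R) hΔ
    (C := ((W.exists_isMinimal R).choose.map (f : K →+* K'))⁻¹) ?_
  rw [hW', minimal, ← map_variableChange, inv_smul_smul]

open Classical in
/-- The local polynomial of a curve with potentially good reduction (for instance one with
`j = 1728`) is invariant under isomorphisms of the base. -/
theorem localPolynomial_map (W : WeierstrassCurve K) (hW : W.Δ ≠ 0) (hc : W.c₄ ^ 3 = 1728 * W.Δ) :
    (W.map (f : K →+* K')).localPolynomial R' = W.localPolynomial R := by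
  obtain ⟨h1, h2⟩ := minimal_map_invariant hf hW rfl
  -- Without multiplicative reduction on either side, the split and non-split cases need no
  -- transport.
  have h3 : ¬ (W.minimal R).HasMultiplicativeReduction R :=
    not_hasMultiplicativeReduction_of_c₄_pow (c₄_pow_minimal hc)
  have h4 : ¬ ((W.map (f : K →+* K')).minimal R').HasMultiplicativeReduction R' := by
    refine not_hasMultiplicativeReduction_of_c₄_pow (c₄_pow_minimal ?_)
    rw [map_c₄, map_Δ, ← map_pow, hc, map_mul, map_ofNat]
  have h5 : ¬ (W.minimal R).HasSplitMultiplicativeReduction R := fun h ↦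
    h3 h.toHasMultiplicativeReduction
  have h6 : ¬ ((W.map (f : K →+* K')).minimal R').HasSplitMultiplicativeReduction R' := fun h ↦
    h4 h.toHasMultiplicativeReduction
  have h7 := Nat.card_congr (IsLocalRing.ResidueField.mapEquiv e).toEquiv
  rw [localPolynomial, localPolynomial]
  simp only [h1, h2, h3, h4, h5, h6, h7, if_false]

theorem localEulerFactor_map (W : WeierstrassCurve K) (hW : W.Δ ≠ 0)
    (hc : W.c₄ ^ 3 = 1728 * W.Δ) :
    (W.map (f : K →+* K')).localEulerFactor R' = W.localEulerFactor R := by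
  have h7 := Nat.card_congr (IsLocalRing.ResidueField.mapEquiv e).toEquiv
  rw [localEulerFactor, localEulerFactor, localPowerSeries, localPowerSeries,
    localPolynomial_map hf W hW hc, h7]

end Transport

end WeierstrassCurve

end

/-! ### Isomorphisms of completions. -/

noncomputable section

section Completion

open Valuation WithVal MonoidWithZeroHom MonoidWithZeroHom.ValueGroup₀

lemma WithVal.continuous_congr {K L Γ : Type*} [Field K] [Field L]
    [LinearOrderedCommGroupWithZero Γ] {v : Valuation K Γ} {w : Valuation L Γ} (f : K ≃+* L)
    (h : ∀ x, w (f x) = v x) : Continuous (WithVal.congr v w f) := by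
  refine continuous_of_continuousAt_zero (WithVal.congr v w f) ?_
  rw [ContinuousAt, map_zero, (Valued.hasBasis_nhds_zero _ _).tendsto_iff
    (Valued.hasBasis_nhds_zero _ _)]
  simp only [true_and, forall_const]
  intro γ
  -- The radius is a quotient of values of field elements; pulling these elements back along `f`
  -- gives a ball of the same radius in the source.
  obtain ⟨r, s, hr₀, hs₀, hr⟩ := exists_div_eq_of_unit (Valued.v (R := WithVal w)) γ
  have hval : ∀ x : WithVal v, Valued.v (WithVal.congr v w f x) = Valued.v x := fun x ↦ h x.ofVal
  obtain ⟨r', rfl⟩ := (WithVal.congr v w f).surjective r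
  obtain ⟨s', rfl⟩ := (WithVal.congr v w f).surjective s
  rw [hval] at hr₀ hs₀
  refine ⟨.mk0 ((Valued.v (R := WithVal v)).restrict r' / (Valued.v (R := WithVal v)).restrict s')
    (div_ne_zero ((restrict_pos_iff _ _).mpr hr₀).ne' ((restrict_pos_iff _ _).mpr hs₀).ne'),
    fun x hx ↦ ?_⟩
  rw [Set.mem_ofPred_eq, Units.val_mk0, lt_div_iff₀ ((restrict_pos_iff _ _).mpr hs₀), ← map_mul,
    restrict_lt_iff] at hx
  rw [Set.mem_ofPred_eq, ← hr, lt_div_iff₀ ((restrict_pos_iff _ _).mpr (by rwa [hval])), ← map_mul,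
    restrict_lt_iff, ← map_mul, hval, hval]
  exact hx

end Completion

namespace IsDedekindDomain.HeightOneSpectrum

variable {A B K L : Type*} [CommRing A] [IsDedekindDomain A] [CommRing B] [IsDedekindDomain B]
  [Field K] [Algebra A K] [IsFractionRing A K] [Field L] [Algebra B L] [IsFractionRing B L]
  {e : A ≃+* B} {f : K ≃+* L} (hf : ∀ r, f (algebraMap A K r) = algebraMap B L (e r))

/-- The valuation of `r` is determined by which powers of the prime contain it, and `e` carries
these powers to one another. -/
lemma intValuation_equivOfRingEquiv (e : A ≃+* B) (v : HeightOneSpectrum A) (r : A) :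
    (equivOfRingEquiv e v).intValuation (e r) = v.intValuation r := by
  by_cases hr : r = 0
  · subst hr
    simp
  have hmem : ∀ n : ℕ, e r ∈ (equivOfRingEquiv e v).asIdeal ^ n ↔ r ∈ v.asIdeal ^ n := by
    intro n
    have : (equivOfRingEquiv e v).asIdeal = v.asIdeal.map e := Ideal.comap_symm e
    rw [this, ← Ideal.map_pow, Ideal.apply_mem_of_equiv_iff]
  have key : ∀ n : ℕ, (equivOfRingEquiv e v).intValuation (e r) ≤ WithZero.exp (-(n : ℤ)) ↔
      v.intValuation r ≤ WithZero.exp (-(n : ℤ)) := fun n ↦ by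
    rw [intValuation_le_pow_iff_mem, intValuation_le_pow_iff_mem, hmem]
  have her : e r ≠ 0 := (map_ne_zero_iff e e.injective).mpr hr
  apply le_antisymm
  · rw [v.intValuation_if_neg hr, key, ← v.intValuation_if_neg hr]
  · rw [(equivOfRingEquiv e v).intValuation_if_neg her, ← key,
      ← (equivOfRingEquiv e v).intValuation_if_neg her]

include hf

lemma valuation_equivOfRingEquiv (v : HeightOneSpectrum A) (x : K) :
    (equivOfRingEquiv e v).valuation L (f x) = v.valuation K x := by
  obtain ⟨a, b, hb, rfl⟩ := IsFractionRing.div_surjective A x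
  rw [map_div₀, map_div₀, map_div₀, hf, hf, valuation_of_algebraMap, valuation_of_algebraMap,
    valuation_of_algebraMap, valuation_of_algebraMap, intValuation_equivOfRingEquiv,
    intValuation_equivOfRingEquiv]

/-- An isomorphism of Dedekind domains induces isomorphisms of completions. -/
theorem exists_adicCompletion_equiv (v : HeightOneSpectrum A) :
    ∃ (F : v.adicCompletion K ≃+* (equivOfRingEquiv e v).adicCompletion L)
      (G : v.adicCompletionIntegers K ≃+* (equivOfRingEquiv e v).adicCompletionIntegers L),
      (∀ r, F (algebraMap (v.adicCompletionIntegers K) (v.adicCompletion K) r) =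
        algebraMap _ ((equivOfRingEquiv e v).adicCompletion L) (G r)) ∧
      ∀ x : K, F (algebraMap K _ x) = algebraMap L _ (f x) := by
  set w := equivOfRingEquiv e v with hw
  have hval : ∀ x, w.valuation L (f x) = v.valuation K x := valuation_equivOfRingEquiv hf v
  have hval' : ∀ x, v.valuation K (f.symm x) = w.valuation L x := fun x ↦ by
    rw [← hval, RingEquiv.apply_symm_apply]
  have hc := WithVal.continuous_congr f hval
  have hc' := WithVal.continuous_congr f.symm hval'
  let F₀ := UniformSpace.Completion.mapRingEquiv
    (WithVal.congr (v.valuation K) (w.valuation L) f) hc hc'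
  let F := ((adicCompletion.equiv K v).trans F₀).trans (adicCompletion.equiv L w).symm
  have hF₀ : ∀ x : WithVal (v.valuation K), F₀ x = (WithVal.congr _ (w.valuation L) f x : _) :=
    UniformSpace.Completion.mapRingHom_coe hc
  have hF : ∀ x : K, F (algebraMap K _ x) = algebraMap L _ (f x) := fun x ↦
    congrArg adicCompletion.ofCompletion (hF₀ (WithVal.toVal _ x))
  let H : (v.valuation K).Completion ≃ₜ (w.valuation L).Completion :=
    { F₀.toEquiv with
      continuous_toFun := UniformSpace.Completion.continuous_map
      continuous_invFun := UniformSpace.Completion.continuous_map }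
  -- Unit balls are clopen, so the equivalence defines a closed set and can be checked on the dense
  -- subfield.
  have hF₀v : ∀ x, Valued.v x ≤ 1 ↔ Valued.v (F₀ x) ≤ 1 := by
    intro x
    induction x using UniformSpace.Completion.induction_on with
    | hp =>
      have h1 (x : (v.valuation K).Completion) :
        Valued.v x ≤ 1 ↔ Valued.v.restrict x ≤ 1 := by rw [Valuation.restrict_le_one_iff]
      have h2 (x : (w.valuation L).Completion) :
        Valued.v x ≤ 1 ↔ Valued.v.restrict x ≤ 1 := by rw [Valuation.restrict_le_one_iff]
      simp_rw [h1, h2]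
      exact H.isClosed_setOfPred_iff (Valued.isClopen_closedBall _ one_ne_zero)
        (Valued.isClopen_closedBall _ one_ne_zero)
    | ih a =>
      rw [hF₀, Valued.valuedCompletion_apply, Valued.valuedCompletion_apply]
      change v.valuation K a.ofVal ≤ 1 ↔ w.valuation L (f a.ofVal) ≤ 1
      rw [hval]
  refine ⟨F, F.restrict _ _ fun x ↦ hF₀v x.toCompletion, fun r ↦ rfl, hF⟩

end IsDedekindDomain.HeightOneSpectrum

end

/-! ### Conjugation of primes, the L-function, and residue fields. -/

noncomputable section

namespace EllipticReduction

variable {K : Type*} [Field K]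

lemma baseChange_conj {L M : Type*} [Field L] [Field M] [Algebra K L] [Algebra K M] {σ : K ≃+* K}
    {F : L ≃+* M} (hF : ∀ x : K, F (algebraMap K L x) = algebraMap K M (σ x))
    (W : WeierstrassCurve K) :
    (W.map (σ : K →+* K)).baseChange M = (W.baseChange L).map (F : L →+* M) := by
  ext <;> simp [WeierstrassCurve.baseChange, hF]

lemma baseChange_Δ_ne_zero {L : Type*} [Field L] [Algebra K L] {W : WeierstrassCurve K}
    (hW : W.Δ ≠ 0) : (W.baseChange L).Δ ≠ 0 := by
  rw [WeierstrassCurve.baseChange, WeierstrassCurve.map_Δ]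
  exact (map_ne_zero _).mpr hW

lemma baseChange_c₄_pow {L : Type*} [Field L] [Algebra K L] {W : WeierstrassCurve K}
    (hc : W.c₄ ^ 3 = 1728 * W.Δ) : (W.baseChange L).c₄ ^ 3 = 1728 * (W.baseChange L).Δ := by
  rw [WeierstrassCurve.baseChange, WeierstrassCurve.map_Δ, WeierstrassCurve.map_c₄, ← map_pow, hc,
    map_mul, map_ofNat]

variable [NumberField K]

/-- Conjugation of primes by an automorphism of the field. -/
abbrev conjPrime (σ : K ≃+* K) : HeightOneSpectrum (𝓞 K) ≃ HeightOneSpectrum (𝓞 K) :=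
  HeightOneSpectrum.equivOfRingEquiv (RingOfIntegers.mapRingEquiv σ)

variable (σ : K ≃+* K) (𝔭 : HeightOneSpectrum (𝓞 K)) {W : WeierstrassCurve K}

theorem goodReductionAt_conj (hW : W.Δ ≠ 0) :
    GoodReductionAt (W.map (σ : K →+* K)) (conjPrime σ 𝔭) ↔ GoodReductionAt W 𝔭 := by
  obtain ⟨F, G, hFG, hF⟩ := HeightOneSpectrum.exists_adicCompletion_equiv
    (e := RingOfIntegers.mapRingEquiv σ) (f := σ) (fun _ ↦ rfl) 𝔭
  exact (WeierstrassCurve.minimal_map_invariant hFG (baseChange_Δ_ne_zero hW)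
    (baseChange_conj hF W)).1

theorem reductionPointCount_conj (hW : W.Δ ≠ 0) :
    reductionPointCount (W.map (σ : K →+* K)) (conjPrime σ 𝔭) = reductionPointCount W 𝔭 := by
  obtain ⟨F, G, hFG, hF⟩ := HeightOneSpectrum.exists_adicCompletion_equiv
    (e := RingOfIntegers.mapRingEquiv σ) (f := σ) (fun _ ↦ rfl) 𝔭
  exact (WeierstrassCurve.minimal_map_invariant hFG (baseChange_Δ_ne_zero hW)
    (baseChange_conj hF W)).2

theorem localPolynomialAt_conj (hW : W.Δ ≠ 0) (hc : W.c₄ ^ 3 = 1728 * W.Δ) :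
    localPolynomialAt (W.map (σ : K →+* K)) (conjPrime σ 𝔭) = localPolynomialAt W 𝔭 := by
  obtain ⟨F, G, hFG, hF⟩ := HeightOneSpectrum.exists_adicCompletion_equiv
    (e := RingOfIntegers.mapRingEquiv σ) (f := σ) (fun _ ↦ rfl) 𝔭
  rw [localPolynomialAt, localPolynomialAt, baseChange_conj hF]
  exact WeierstrassCurve.localPolynomial_map hFG _ (baseChange_Δ_ne_zero hW) (baseChange_c₄_pow hc)

theorem LFunction_conj (hW : W.Δ ≠ 0) (hc : W.c₄ ^ 3 = 1728 * W.Δ) :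
    (W.map (σ : K →+* K)).LFunction = W.LFunction := by
  have h : ∀ 𝔭 : HeightOneSpectrum (𝓞 K),
      ((W.map (σ : K →+* K)).baseChange ((conjPrime σ 𝔭).adicCompletion K)).localEulerFactor
        ((conjPrime σ 𝔭).adicCompletionIntegers K) =
      (W.baseChange (𝔭.adicCompletion K)).localEulerFactor (𝔭.adicCompletionIntegers K) := by
    intro 𝔭
    obtain ⟨F, G, hFG, hF⟩ := HeightOneSpectrum.exists_adicCompletion_equiv
      (e := RingOfIntegers.mapRingEquiv σ) (f := σ) (fun _ ↦ rfl) 𝔭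
    rw [baseChange_conj hF]
    exact WeierstrassCurve.localEulerFactor_map hFG _ (baseChange_Δ_ne_zero hW)
      (baseChange_c₄_pow hc)
  rw [WeierstrassCurve.LFunction, WeierstrassCurve.LFunction]
  simp_rw [← h]
  unfold ArithmeticFunction.eulerProduct
  let : UniformSpace (ArithmeticFunction ℤ) := ArithmeticFunction.uniformSpace
  -- An unconditional product is unchanged by a permutation of its index set, so no convergence
  -- argument is needed.
  exact ((conjPrime σ).tprod_eq (fun 𝔮 ↦ ((W.map (σ : K →+* K)).baseChange
    (𝔮.adicCompletion K)).localEulerFactor (𝔮.adicCompletionIntegers K))).symm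

/-- The reduction map from the integers of `K` to the residue field of the completion at `𝔭`. -/
def residueMap : 𝓞 K →+* IsLocalRing.ResidueField (𝔭.adicCompletionIntegers K) :=
  (IsLocalRing.residue _).comp (algebraMap (𝓞 K) (𝔭.adicCompletionIntegers K))

lemma residue_eq_zero_iff_valued {x : 𝔭.adicCompletionIntegers K} :
    IsLocalRing.residue _ x = 0 ↔ Valued.v (x : 𝔭.adicCompletion K) < 1 := by
  rw [IsLocalRing.residue_eq_zero_iff, IsLocalRing.mem_maximalIdeal, mem_nonunits_iff,
    HeightOneSpectrum.adicCompletionIntegers.isUnit_iff_valued_eq_one]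
  exact ⟨fun h ↦ lt_of_le_of_ne x.2 h, fun h ↦ h.ne⟩

lemma residueMap_eq_zero_iff {r : 𝓞 K} : residueMap 𝔭 r = 0 ↔ r ∈ 𝔭.asIdeal := by
  rw [residueMap, RingHom.comp_apply, residue_eq_zero_iff_valued,
    ← HeightOneSpectrum.valuation_lt_one_iff_mem (K := K),
    ← HeightOneSpectrum.adicCompletion.valued_coe]
  rfl

/-- Density of `K` in the completion gives a nearby element of `K` with valuation at most one, which
is congruent modulo `𝔭` to an algebraic integer. -/
lemma residueMap_surjective : Function.Surjective (residueMap 𝔭) := by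
  intro x
  obtain ⟨x, rfl⟩ := IsLocalRing.residue_surjective x
  obtain ⟨_, ⟨k, rfl⟩, hy⟩ := (HeightOneSpectrum.denseRange_algebraMap K 𝔭).inter_nhds_nonempty
    (Valued.mem_nhds.mpr ⟨1, Set.Subset.rfl⟩ :
      {y | Valued.v.restrict (y - (x : 𝔭.adicCompletion K)) < (1 : (_)ˣ).1} ∈ nhds _)
  have hk : Valued.v (algebraMap K (𝔭.adicCompletion K) k - x) < 1 := by
    simpa [Valuation.restrict_lt_one_iff] using hy
  have hk1 : 𝔭.valuation K k ≤ 1 := by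
    rw [← HeightOneSpectrum.adicCompletion.valued_coe]
    have := Valued.v.map_add (algebraMap K (𝔭.adicCompletion K) k - x) x
    rw [sub_add_cancel] at this
    exact this.trans (max_le hk.le x.2)
  obtain ⟨r, hr⟩ := HeightOneSpectrum.exists_valuation_sub_lt_of_integer 𝔭 hk1 1
  refine ⟨r, ?_⟩
  rw [residueMap, RingHom.comp_apply, ← sub_eq_zero, ← map_sub, residue_eq_zero_iff_valued]
  have h1 : Valued.v (algebraMap K (𝔭.adicCompletion K) (algebraMap (𝓞 K) K r - k)) < 1 := by
    rw [← HeightOneSpectrum.adicCompletion.valued_coe] at hr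
    exact hr
  have h2 := Valued.v.map_add (algebraMap K (𝔭.adicCompletion K) (algebraMap (𝓞 K) K r - k))
    (algebraMap K (𝔭.adicCompletion K) k - x)
  rw [map_sub, sub_add_sub_cancel] at h2
  rw [map_sub] at h1
  exact h2.trans_lt (max_lt h1 hk)

lemma card_residueField : Nat.card (IsLocalRing.ResidueField (𝔭.adicCompletionIntegers K)) =
    Ideal.absNorm 𝔭.asIdeal := by
  have hker : RingHom.ker (residueMap 𝔭) = 𝔭.asIdeal := by
    ext r
    exact residueMap_eq_zero_iff 𝔭
  rw [← Nat.card_congr (RingHom.quotientKerEquivOfSurjective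
    (residueMap_surjective 𝔭)).toEquiv, hker]
  rfl

end EllipticReduction

end

/-! ### Reduction at primes of norm five. -/

noncomputable section

namespace WeierstrassCurve

/-- A curve whose equation reduces to an elliptic curve has good reduction, and the number of points
of the reduction is computed on that equation. -/
theorem hasGoodReduction_of_reduction {R K : Type*} [CommRing R] [IsDomain R]
    [IsDiscreteValuationRing R] [Field K] [Algebra R K] [IsFractionRing R K]
    (A : WeierstrassCurve R) (hA : (A.map (IsLocalRing.residue R)).Δ ≠ 0)
    {W : WeierstrassCurve K} (hW : W = A.baseChange K) :
    (W.minimal R).HasGoodReduction R ∧ Nat.card ((W.minimal R).reduction R).toAffine.Point =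
      Nat.card (A.map (IsLocalRing.residue R)).toAffine.Point := by
  subst hW
  have hint : IsIntegral R (A.baseChange K) := ⟨A, rfl⟩
  have hu : IsUnit A.Δ := by
    rw [map_Δ, IsLocalRing.residue_ne_zero_iff_isUnit] at hA
    exact hA
  have hΔ : (A.baseChange K).Δ = algebraMap R K A.Δ := map_Δ ..
  have hdvd : ∃ r : R, 1 = algebraMap R K r * (A.baseChange K).Δ := by
    obtain ⟨r, hr⟩ := hu.exists_left_inv
    exact ⟨r, by rw [hΔ, ← map_mul, hr, map_one]⟩
  have hmin : IsMinimal R (A.baseChange K) := isMinimal_of_isUnit_Δ hdvd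
  have hmodel : integralModel R (A.baseChange K) = A :=
    map_injective (IsFractionRing.injective R K) (baseChange_integralModel_eq R (A.baseChange K))
  have hne : (A.baseChange K).Δ ≠ 0 := by
    rw [hΔ]
    exact (hu.map (algebraMap R K)).ne_zero
  obtain ⟨h1, h2⟩ := minimal_reduction_invariant (e := RingEquiv.refl R) (f := RingEquiv.refl K)
    (fun _ ↦ rfl) (A.baseChange K) hne (W' := A.baseChange K) (C := 1) (by
      rw [one_smul]
      exact (map_id _).symm)
  refine ⟨h1.mpr (hasGoodReduction_iff_dvd.mpr hdvd), ?_⟩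
  rw [h2, reduction, hmodel]

end WeierstrassCurve

namespace GaussianField

open EllipticReduction Polynomial

/-- The curve `y² = x³ + ax`. -/
def quarticCurve {R : Type*} [CommRing R] (a : R) : WeierstrassCurve R := ⟨0, 0, 0, a, 0⟩

lemma quarticCurve_map {R S : Type*} [CommRing R] [CommRing S] (f : R →+* S) (a : R) :
    (quarticCurve a).map f = quarticCurve (f a) := by
  ext <;> simp [quarticCurve]

lemma quarticCurve_Δ {R : Type*} [CommRing R] (a : R) : (quarticCurve a).Δ = -64 * a ^ 3 := by
  simp [quarticCurve, WeierstrassCurve.Δ, WeierstrassCurve.b₂, WeierstrassCurve.b₄,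
    WeierstrassCurve.b₆, WeierstrassCurve.b₈]
  ring

lemma E_Δ_ne_zero : E.Δ ≠ 0 := by
  change (quarticCurve i).Δ ≠ 0
  have hi0 : i ≠ 0 := fun h0 ↦ by simpa [h0] using i_sq
  rw [quarticCurve_Δ]
  exact mul_ne_zero (by norm_num) (pow_ne_zero _ hi0)

lemma E_c₄_pow : E.c₄ ^ 3 = 1728 * E.Δ := by
  simp [E, WeierstrassCurve.c₄, WeierstrassCurve.Δ, WeierstrassCurve.b₂, WeierstrassCurve.b₄,
    WeierstrassCurve.b₆, WeierstrassCurve.b₈]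
  ring

/-- Reduction of `y² = x³ + ix` at a prime with residue field of five elements. -/
theorem reduction_of_absNorm_eq_five {𝔭 : HeightOneSpectrum (𝓞 QI)}
    (h5 : Ideal.absNorm 𝔭.asIdeal = 5) {c : ℕ} (hc : (c : ZMod 5) ≠ 0)
    (hmem : iInt - c ∈ 𝔭.asIdeal) :
    GoodReductionAt E 𝔭 ∧ reductionPointCount E 𝔭 =
        Nat.card (quarticCurve (c : ZMod 5)).toAffine.Point ∧
      localPolynomialAt E 𝔭 =
        1 - C (6 - (Nat.card (quarticCurve (c : ZMod 5)).toAffine.Point : ℤ)) * X +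
          C 5 * X ^ 2 := by
  have h64 : (-64 : ZMod 5) ≠ 0 := by decide
  set k := IsLocalRing.ResidueField (𝔭.adicCompletionIntegers QI)
  have hk : Nat.card k = 5 := (card_residueField 𝔭).trans h5
  have : Finite k := Nat.finite_of_card_ne_zero (by rw [hk]; norm_num)
  have : Fintype k := Fintype.ofFinite k
  have : Fact (Nat.Prime 5) := ⟨by norm_num⟩
  -- The residue field has five elements, hence is `ZMod 5`, and the hypothesis on `iInt - c`
  -- identifies the image of `i` with `c`.
  let e : ZMod 5 ≃+* k := ZMod.ringEquivOfPrime k (by norm_num)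
    (by rw [← Nat.card_eq_fintype_card, hk])
  let A : WeierstrassCurve (𝔭.adicCompletionIntegers QI) :=
    quarticCurve (algebraMap (𝓞 QI) (𝔭.adicCompletionIntegers QI) iInt)
  have hres : residueMap 𝔭 iInt = e c := by
    rw [map_natCast, ← map_natCast (residueMap 𝔭), ← sub_eq_zero, ← map_sub, residueMap_eq_zero_iff]
    exact hmem
  have hAk : A.map (IsLocalRing.residue _) =
      (quarticCurve (c : ZMod 5)).map (e : ZMod 5 →+* k) := by
    rw [quarticCurve_map, quarticCurve_map]
    exact congrArg quarticCurve hres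
  have hA : (A.map (IsLocalRing.residue _)).Δ ≠ 0 := by
    rw [hAk, WeierstrassCurve.map_Δ, quarticCurve_Δ]
    refine (map_ne_zero_iff _ e.injective).mpr (mul_ne_zero h64 (pow_ne_zero _ hc))
  have hE : E.baseChange (𝔭.adicCompletion QI) = A.baseChange (𝔭.adicCompletion QI) := by
    rw [WeierstrassCurve.baseChange, WeierstrassCurve.baseChange, quarticCurve_map]
    change (quarticCurve i).map _ = _
    rw [quarticCurve_map]
    rfl
  obtain ⟨h1, h2⟩ := WeierstrassCurve.hasGoodReduction_of_reduction A hA hE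
  rw [hAk, WeierstrassCurve.card_point_map] at h2
  refine ⟨h1, h2, ?_⟩
  rw [localPolynomialAt, WeierstrassCurve.localPolynomial]
  rw [if_pos h1, h2]
  change 1 - C ((Nat.card k : ℤ) + 1 - _) * X + C (Nat.card k : ℤ) * X ^ 2 = _
  rw [hk]
  norm_num

/-- Every affine solution is nonsingular, which leaves a decidable count; the extra `1` is the point
at infinity. -/
lemma card_quarticCurve_zmod_five {a : ZMod 5} (ha : a ≠ 0) :
    Nat.card (quarticCurve a).toAffine.Point =
      Fintype.card {p : ZMod 5 × ZMod 5 // p.2 ^ 2 = p.1 ^ 3 + a * p.1} + 1 := by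
  have h2 : (2 : ZMod 5) ≠ 0 := by decide
  have : Fact (Nat.Prime 5) := ⟨by norm_num⟩
  have hW : WeierstrassCurve.Affine.IsQuartic a (quarticCurve a) :=
    ⟨h2, ha, rfl, rfl, rfl, rfl, rfl⟩
  rw [Nat.card_congr (WeierstrassCurve.Affine.nonsingularPointEquiv _), WithZero,
    ← Fintype.card_option, ← Nat.card_eq_fintype_card]
  exact Nat.card_congr (Equiv.optionCongr (Equiv.subtypeEquivRight fun p ↦ hW.nonsingular_iff))

lemma card_three : Nat.card (quarticCurve (3 : ZMod 5)).toAffine.Point = 10 := by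
  rw [card_quarticCurve_zmod_five (by decide)]
  decide

lemma card_two : Nat.card (quarticCurve (2 : ZMod 5)).toAffine.Point = 2 := by
  rw [card_quarticCurve_zmod_five (by decide)]
  decide

end GaussianField

end

/-! ### Complex conjugation on ℚ(i) and the two primes above 5. -/

noncomputable section

namespace GaussianField

open EllipticReduction Polynomial

lemma finrank_eq_two : Module.finrank ℚ QI = 2 := by
  rw [IntermediateField.adjoin.finrank isIntegral_complex_I]
  refine le_antisymm ?_ ?_
  · have h : minpoly ℚ Complex.I ∣ X ^ 2 + 1 := minpoly.dvd _ _ (by simp)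
    refine (natDegree_le_of_dvd h (Monic.ne_zero (by monicity!))).trans ?_
    compute_degree
  · rw [minpoly.two_le_natDegree_iff isIntegral_complex_I]
    rintro ⟨q, hq⟩
    simpa using congrArg Complex.im hq

/-- Complex conjugation on `ℚ(i)`, as a homomorphism. -/
def conjHom : QI →ₐ[ℚ] QI :=
  (((Complex.conjAe : ℂ →ₐ[ℝ] ℂ).restrictScalars ℚ).comp QI.val).codRestrict QI.toSubalgebra (by
    intro x
    obtain ⟨a, b, rfl⟩ := exists_eq_add_mul_i x
    have h : ((a : QI) + b * (-i)).1 ∈ QI := Subtype.prop _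
    simpa [i] using h)

lemma conjHom_i : conjHom i = -i := by
  apply Subtype.ext
  exact Complex.conj_I

/-- The nontrivial automorphism of `ℚ(i)`. -/
def conj : QI ≃ₐ[ℚ] QI :=
  have h : conjHom.comp conjHom = AlgHom.id ℚ QI := by
    ext x
    obtain ⟨a, b, rfl⟩ := exists_eq_add_mul_i x
    simp [conjHom_i]
  AlgEquiv.ofAlgHom conjHom conjHom h h

lemma conj_i : conj i = -i := conjHom_i

/-- Complex conjugation on the Gaussian integers. -/
abbrev conjInt : 𝓞 QI ≃+* 𝓞 QI := RingOfIntegers.mapRingEquiv (conj : QI ≃+* QI)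

lemma conjInt_iInt : conjInt iInt = -iInt := RingOfIntegers.ext conj_i

lemma iInt_sq : iInt ^ 2 = -1 := RingOfIntegers.ext i_sq

lemma map_conjInt_span : (Ideal.span {2 + iInt}).map conjInt = Ideal.span {2 - iInt} := by
  rw [Ideal.map_span, Set.image_singleton, map_add, map_ofNat, conjInt_iInt, ← sub_eq_add_neg]

/-- The two ideals are conjugate, so of equal norm, and their product `(5)` has norm `25`. This
avoids any description of the ring of integers. -/
lemma absNorm_span : Ideal.absNorm (Ideal.span {2 + iInt}) = 5 ∧
    Ideal.absNorm (Ideal.span {2 - iInt}) = 5 := by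
  have h1 : Ideal.absNorm (Ideal.span {2 + iInt}) = Ideal.absNorm (Ideal.span {2 - iInt}) :=
    Nat.card_congr (Ideal.quotientEquiv _ _ conjInt map_conjInt_span.symm).toEquiv
  have h2 : Ideal.absNorm (Ideal.span {2 + iInt}) * Ideal.absNorm (Ideal.span {2 - iInt}) = 25 := by
    have h : (2 + iInt) * (2 - iInt) = algebraMap ℤ (𝓞 QI) 5 := by
      rw [map_ofNat]
      linear_combination -iInt_sq
    rw [← map_mul, Ideal.span_singleton_mul_span_singleton, h, Ideal.absNorm_span_singleton,
      Algebra.norm_algebraMap, RingOfIntegers.rank, finrank_eq_two]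
    rfl
  rw [← h1] at h2 ⊢
  exact ⟨by nlinarith, by nlinarith⟩

/-- A prime of `ℚ(i)` from an ideal of norm five. -/
def primeOfNormFive {I : Ideal (𝓞 QI)} (h : Ideal.absNorm I = 5) : HeightOneSpectrum (𝓞 QI) where
  asIdeal := I
  isPrime := Ideal.isPrime_of_irreducible_absNorm (by rw [h]; exact Nat.prime_five)
  ne_bot := by
    rintro rfl
    simp at h

/-- The prime `(2 + i)`. -/
def primeAdd : HeightOneSpectrum (𝓞 QI) := primeOfNormFive absNorm_span.1

/-- The prime `(2 - i)`. -/
def primeSub : HeightOneSpectrum (𝓞 QI) := primeOfNormFive absNorm_span.2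

lemma conjPrime_primeAdd : conjPrime (conj : QI ≃+* QI) primeAdd = primeSub := by
  apply HeightOneSpectrum.ext
  refine Eq.trans ?_ map_conjInt_span
  exact Ideal.comap_symm conjInt

lemma reduction_primeAdd : GoodReductionAt E primeAdd ∧ reductionPointCount E primeAdd = 10 ∧
    localPolynomialAt E primeAdd = 1 - C (-4) * X + C 5 * X ^ 2 := by
  -- Modulo `2 + i` one has `i ≡ -2 ≡ 3`; explicitly `(i - 1)(2 + i) = i - 3`.
  have h := reduction_of_absNorm_eq_five (𝔭 := primeAdd) absNorm_span.1 (c := 3) (by decide)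
    (Ideal.mem_span_singleton'.mpr ⟨iInt - 1, by push_cast; linear_combination iInt_sq⟩)
  rw [show ((3 : ℕ) : ZMod 5) = 3 from rfl, card_three] at h
  exact h

lemma reduction_primeSub : GoodReductionAt E primeSub ∧ reductionPointCount E primeSub = 2 ∧
    localPolynomialAt E primeSub = 1 - C 4 * X + C 5 * X ^ 2 := by
  have h := reduction_of_absNorm_eq_five (𝔭 := primeSub) absNorm_span.2 (c := 2) (by decide)
    (Ideal.mem_span_singleton'.mpr ⟨-1, by push_cast; ring⟩)
  rw [show ((2 : ℕ) : ZMod 5) = 2 from rfl, card_two] at h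
  exact h

end GaussianField

end

/-! ### The main theorem. -/

theorem mainTheorem7 :
    (¬ ∀ (K : Type) [Field K] [NumberField K] (A A' : WeierstrassCurve K)
        [A.IsElliptic] [A'.IsElliptic], A.LFunction = A'.LFunction → Isogenous A A') ∧
    ∃ σ : QI ≃ₐ[ℚ] QI, σ i = -i ∧
    ∃ Eσ : WeierstrassCurve QI,
      Eσ = E.map (σ : QI →+* QI) ∧
      E.IsElliptic ∧ Eσ.IsElliptic ∧
      E.LFunction = Eσ.LFunction ∧
      E.LSeries = Eσ.LSeries ∧
      ¬ Isogenous E Eσ ∧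
      ∃ 𝔭₁ 𝔭₂ : HeightOneSpectrum (𝓞 QI),
        𝔭₁.asIdeal = Ideal.span {2 + iInt} ∧
        𝔭₂.asIdeal = Ideal.span {2 - iInt} ∧
        GoodReductionAt E 𝔭₁ ∧ GoodReductionAt E 𝔭₂ ∧
        GoodReductionAt Eσ 𝔭₂ ∧
        reductionPointCount E 𝔭₁ = 10 ∧
        reductionPointCount E 𝔭₂ = 2 ∧
        reductionPointCount Eσ 𝔭₂ = 10 ∧
        localPolynomialAt E 𝔭₁ = localPolynomialAt Eσ 𝔭₂ ∧
        localPolynomialAt E 𝔭₂ ≠ localPolynomialAt Eσ 𝔭₂ := by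
  have hE : E.IsElliptic := ⟨E_Δ_ne_zero.isUnit⟩
  have hEσ : (E.map (conj : QI →+* QI)).IsElliptic := inferInstance
  have hL : E.LFunction = (E.map (conj : QI →+* QI)).LFunction :=
    (LFunction_conj (conj : QI ≃+* QI) E_Δ_ne_zero E_c₄_pow).symm
  have hnot : ¬ Isogenous E (E.map (conj : QI →+* QI)) := not_isogenous conj_i
  have hgood := goodReductionAt_conj (conj : QI ≃+* QI) primeAdd E_Δ_ne_zero
  have hcount := reductionPointCount_conj (conj : QI ≃+* QI) primeAdd E_Δ_ne_zero
  have hpoly := localPolynomialAt_conj (conj : QI ≃+* QI) primeAdd E_Δ_ne_zero E_c₄_pow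
  rw [conjPrime_primeAdd] at hgood hcount hpoly
  obtain ⟨h1, h2, h3⟩ := reduction_primeAdd
  obtain ⟨h4, h5, h6⟩ := reduction_primeSub
  refine ⟨fun h ↦ hnot (h QI _ _ hL), conj, conj_i, _, rfl, hE, hEσ, hL, ?_, hnot, primeAdd,
    primeSub, rfl, rfl, h1, h4, hgood.mpr h1, h2, h5, hcount.trans h2, hpoly.symm, ?_⟩
  · funext s
    simp only [WeierstrassCurve.LSeries, hL]
  -- At `(2 - i)` the linear coefficients are `-4` for the curve and `4` for its conjugate.
  · intro h
    have h' := h.trans hpoly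
    rw [h3, h6] at h'
    have := congrArg (fun p ↦ p.coeff 1) h'
    simp [Polynomial.coeff_one, Polynomial.coeff_X] at this
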